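/- Let $n\ge 0$ be an integer, let $\alpha,\beta,\gamma>0$ be real, and let $A,B$ be real constants with $A\ge 0$, $A+B\ge 0$ and $(A,B)\ne(0,0)$. For $x\in[0,1]$ and $t\in(0,1)$ put $$w(x,t)=x^{\alpha}(1-x)^{\beta}|x-t|^{\gamma}\bigl(A+B\,\theta(x-t)\bigr),$$ where $\theta(x)=1$ for $x>0$ and $\theta(x)=0$ otherwise, and let $$D_n(t)=\det\left(\int_0^1 x^{i+j}w(x,t)\,dx\right)_{i,j=0}^{n-1}$$ (with $D_0=1$). Then $D_n$ is positive and differentiable on $(0,1)$. Let $$H_n(t)=t(t-1)\frac{d}{dt}\ln D_n(t),\qquad \sigma_n(t)=H_n(t)+c_1t+c_2,$$ where $$c_1=-n(n+\alpha+\beta+\gamma)-\frac{(\alpha+\beta)^2}{4},\qquad c_2=\frac14\bigl[2n(n+\alpha+\beta+\gamma)+(\alpha+\beta)\beta-(\alpha-\beta)\gamma\bigr].$$ Then $\sigma_n$ is twice differentiable on $(0,1)$ and satisfies there the Jimbo–Miwa–Okamoto $\sigma$-form of Painlevé VI, $$\sigma_n'\left[t(t-1)\sigma_n''\right]^2+\left[2\sigma_n'(t\sigma_n'-\sigma_n)-(\sigma_n')^2-\nu_1\nu_2\nu_3\nu_4\right]^2=(\sigma_n'+\nu_1^2)(\sigma_n'+\nu_2^2)(\sigma_n'+\nu_3^2)(\sigma_n'+\nu_4^2),$$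 with the parameters $$\nu_1=\frac{\alpha+\beta}{2},\quad \nu_2=\frac{\beta-\alpha}{2},\quad \nu_3=\frac{2n+\alpha+\beta}{2},\quad \nu_4=\frac{2n+\alpha+\beta+2\gamma}{2}.$$ -/

import Mathlib

noncomputable section

namespace DegenerateJacobi

/-- The Heaviside step function: `1` for `x > 0` and `0` otherwise. -/
def heaviside (x : ℝ) : ℝ := if 0 < x then 1 else 0

/-- The weight `x ^ α * (1 - x) ^ β * |x - t| ^ γ * (A + B * θ (x - t))`, used for `x ∈ [0, 1]`. -/
def weight (α β γ A B t x : ℝ) : ℝ :=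
  x ^ α * (1 - x) ^ β * |x - t| ^ γ * (A + B * heaviside (x - t))

/-- The moment `∫₀¹ x ^ k w(x, t) dx`. -/
def moment (α β γ A B : ℝ) (k : ℕ) (t : ℝ) : ℝ :=
  ∫ x in (0 : ℝ)..1, x ^ k * weight α β γ A B t x

/-- The Hankel determinant `D_n(t) = det (∫₀¹ x ^ (i + j) w(x, t) dx)`, `0 ≤ i, j ≤ n - 1`. -/
def hankelDet (α β γ A B : ℝ) (n : ℕ) (t : ℝ) : ℝ :=
  (Matrix.of fun i j : Fin n => moment α β γ A B ((i : ℕ) + (j : ℕ)) t).det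

/-- `H_n(t) = t (t - 1) (d/dt) log D_n(t)`. -/
def hamiltonian (α β γ A B : ℝ) (n : ℕ) (t : ℝ) : ℝ :=
  t * (t - 1) * deriv (fun s => Real.log (hankelDet α β γ A B n s)) t

/-- `σ` is twice differentiable at every point of the (open) set `U` and solves there the
Jimbo-Miwa-Okamoto `σ`-form of the sixth Painlevé equation with parameters `ν₁, ν₂, ν₃, ν₄`. -/
def SolvesSigmaPVI (ν₁ ν₂ ν₃ ν₄ : ℝ) (σ : ℝ → ℝ) (U : Set ℝ) : Prop :=
  ∀ t ∈ U, DifferentiableAt ℝ σ t ∧ DifferentiableAt ℝ (deriv σ) t ∧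
    deriv σ t * (t * (t - 1) * deriv (deriv σ) t) ^ 2
      + (2 * deriv σ t * (t * deriv σ t - σ t) - (deriv σ t) ^ 2 - ν₁ * ν₂ * ν₃ * ν₄) ^ 2
      = (deriv σ t + ν₁ ^ 2) * (deriv σ t + ν₂ ^ 2)
        * (deriv σ t + ν₃ ^ 2) * (deriv σ t + ν₄ ^ 2)

end DegenerateJacobi

end

/-! The proof is an isomonodromy argument made algebraic. Write N for the matrix size, P for the
monic orthogonal polynomial of degree N, and Q for the polynomial of degree at most N - 1 dual to
the top power. Let `f₀`, `f₁`, `f` be integration against w/x, w/(x-1), w/(x-t). The products Q(c)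
f_c(P), P(c) f_c(P), Q(c) f_c(Q) at c = 0, 1, t play the part of the residues of the Lax matrix.

Pearson's relation (the integral of (pw)' vanishes), applied to P², Q², PQ and xPQ, gives four
linear relations among these residues. Together with the Wronskian relation at each pole they
express everything through p, the subleading coefficient of P, and g = γ Q(t) f(P), up to the square
root of a discriminant (`residue_relation`).

Every t-derivative reduces to one fact: P' and Q' are multiples of the Christoffel-Darboux kernel at
t. Hence p' = g, and the residue at 0 has derivative (γ/t)W, where W² is that discriminant divided
by (αγ)². This gives t(t-1)g' = αγW. Jacobi's formula makes H affine in p, with coefficients affine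
in t (`hasDerivAt_det_hankel`), so σ' is affine in g and the σ-form becomes a polynomial identity
(`sigma_form_identity`).

On the analytic side only contiguity, integration by parts and differentiation in t of incomplete
Beta integrals are needed, and positivity of the Hankel form. -/

namespace DegenerateJacobi

/-! ### Incomplete Beta integrals: contiguity, integration by parts, derivative in t -/

open MeasureTheory Set Filter Topology intervalIntegral

/-- The incomplete Beta-type integral `∫₀ᵗ x ^ a (1 - x) ^ b (t - x) ^ c dx`. -/
noncomputable def partialInt (a b c t : ℝ) : ℝ :=
  ∫ x in (0 : ℝ)..t, x ^ a * (1 - x) ^ b * (t - x) ^ c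

theorem intervalIntegrable_rpow_mul_sub_rpow {a c : ℝ} (ha : -1 < a) (hc : -1 < c) {t : ℝ}
    (ht : 0 < t) : IntervalIntegrable (fun x : ℝ => x ^ a * (t - x) ^ c) volume 0 t := by
  have hleft : ∀ {a c : ℝ}, -1 < a →
      IntervalIntegrable (fun x : ℝ => x ^ a * (t - x) ^ c) volume 0 (t / 2) := by
    intro a c ha
    refine (intervalIntegrable_rpow' ha).mul_continuousOn ?_
    rw [uIcc_of_le (by linarith)]
    refine ContinuousOn.rpow_const (by fun_prop) fun x hx => Or.inl ?_
    have := hx.2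
    linarith
  refine (hleft ha).trans ?_
  -- The reflection x ↦ t - x exchanges the two exponents, so the right half is a left half again.
  have h := ((hleft (c := a) hc).comp_sub_left t).symm
  simp only [sub_zero, sub_sub_cancel, sub_half] at h
  simpa only [mul_comm] using h

theorem intervalIntegrable_partialInt {a c : ℝ} (ha : -1 < a) (b : ℝ) (hc : -1 < c) {t : ℝ}
    (ht : t ∈ Ioo (0 : ℝ) 1) :
    IntervalIntegrable (fun x : ℝ => x ^ a * (1 - x) ^ b * (t - x) ^ c) volume 0 t := by
  have h := (intervalIntegrable_rpow_mul_sub_rpow ha hc ht.1).mul_continuousOn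
    (g := fun x => (1 - x) ^ b) (by
      rw [uIcc_of_le ht.1.le]
      refine ContinuousOn.rpow_const (by fun_prop) fun x hx => Or.inl ?_
      have := hx.2; have := ht.2
      linarith)
  refine h.congr fun x _ => ?_
  ring

theorem partialInt_add_one_left {a c : ℝ} (ha : -1 < a) (b : ℝ) (hc : -1 < c) {t : ℝ}
    (ht : t ∈ Ioo (0 : ℝ) 1) :
    partialInt (a + 1) b c t + partialInt a (b + 1) c t = partialInt a b c t := by
  unfold partialInt
  rw [← integral_add (intervalIntegrable_partialInt (by linarith) b hc ht)
    (intervalIntegrable_partialInt ha (b + 1) hc ht)]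
  refine integral_congr_Ioo_of_le ht.1.le fun x hx => ?_
  have h1 : (0 : ℝ) < 1 - x := by linarith [hx.2, ht.2]
  simp only [Real.rpow_add hx.1, Real.rpow_add h1, Real.rpow_one]
  ring

theorem partialInt_add_one_right {a c : ℝ} (ha : -1 < a) (b : ℝ) (hc : -1 < c) {t : ℝ}
    (ht : t ∈ Ioo (0 : ℝ) 1) :
    partialInt (a + 1) b c t + partialInt a b (c + 1) t = t * partialInt a b c t := by
  unfold partialInt
  rw [← integral_add (intervalIntegrable_partialInt (by linarith) b hc ht)
    (intervalIntegrable_partialInt ha b (by linarith) ht), ← intervalIntegral.integral_const_mul]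
  refine integral_congr_Ioo_of_le ht.1.le fun x hx => ?_
  have h1 : (0 : ℝ) < t - x := by linarith [hx.2]
  simp only [Real.rpow_add hx.1, Real.rpow_add h1, Real.rpow_one]
  ring

/-- The integrand of the combination is the derivative of x^a (1-x)^b (t-x)^c, which vanishes at
both ends because a and c are positive. -/
theorem partialInt_by_parts {a c : ℝ} (ha : 0 < a) (b : ℝ) (hc : 0 < c) {t : ℝ}
    (ht : t ∈ Ioo (0 : ℝ) 1) :
    a * partialInt (a - 1) b c t - b * partialInt a (b - 1) c t
      - c * partialInt a b (c - 1) t = 0 := by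
  unfold partialInt
  have i1 := (intervalIntegrable_partialInt (a := a - 1) (by linarith) b
    (show -1 < c by linarith) ht).const_mul a
  have i2 := (intervalIntegrable_partialInt (a := a) (by linarith) (b - 1)
    (show -1 < c by linarith) ht).const_mul b
  have i3 := (intervalIntegrable_partialInt (a := a) (by linarith) b
    (show -1 < c - 1 by linarith) ht).const_mul c
  rw [← intervalIntegral.integral_const_mul, ← intervalIntegral.integral_const_mul,
    ← intervalIntegral.integral_const_mul, ← integral_sub i1 i2, ← integral_sub (i1.sub i2) i3,
    integral_eq_sub_of_hasDerivAt_of_le ht.1.le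
      (f := fun x => x ^ a * (1 - x) ^ b * (t - x) ^ c) ?_ ?_ ((i1.sub i2).sub i3)]
  · simp [Real.zero_rpow ha.ne', Real.zero_rpow hc.ne']
  · refine ContinuousOn.mul (ContinuousOn.mul ?_ ?_) ?_
    · exact ContinuousOn.rpow_const (by fun_prop) fun x _ => Or.inr ha.le
    · refine ContinuousOn.rpow_const (by fun_prop) fun x hx => Or.inl ?_
      have := hx.2; have := ht.2
      linarith
    · exact ContinuousOn.rpow_const (by fun_prop) fun x _ => Or.inr hc.le
  · intro x hx
    have h1 : (0 : ℝ) < 1 - x := by linarith [hx.2, ht.2]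
    have h2 : (0 : ℝ) < t - x := by linarith [hx.2]
    have d := (((hasDerivAt_id x).rpow_const (p := a) (Or.inl hx.1.ne')).mul
      (((hasDerivAt_id x).const_sub 1).rpow_const (p := b) (Or.inl h1.ne'))).mul
      (((hasDerivAt_id x).const_sub t).rpow_const (p := c) (Or.inl h2.ne'))
    refine d.congr_deriv ?_
    simp only [id, Pi.mul_apply]
    ring

/-- Substituting x = ts fixes the interval and leaves t only in the smooth factor (1 - ts)^b, so
that one can differentiate under the integral. -/
theorem partialInt_scale {a b c t : ℝ} (ht : 0 < t) :
    partialInt a b c t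
      = t ^ (a + c + 1) * ∫ s in (0 : ℝ)..1, s ^ a * (1 - t * s) ^ b * (1 - s) ^ c := by
  have h := intervalIntegral.mul_integral_comp_mul_left (a := 0) (b := 1)
    (f := fun x => x ^ a * (1 - x) ^ b * (t - x) ^ c) t
  rw [mul_zero, mul_one] at h
  rw [partialInt, ← h, ← intervalIntegral.integral_const_mul,
    ← intervalIntegral.integral_const_mul]
  refine integral_congr_Ioo_of_le zero_le_one fun s hs => ?_
  have h1 : t - t * s = t * (1 - s) := by ring
  have h2 : (0 : ℝ) ≤ 1 - s := by linarith [hs.2]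
  simp only [h1, Real.mul_rpow ht.le hs.1.le, Real.mul_rpow ht.le h2, Real.rpow_add ht,
    Real.rpow_one]
  ring

theorem hasDerivAt_scaledInt {a c : ℝ} (ha : -1 < a) (b : ℝ) (hc : -1 < c) {t : ℝ}
    (ht : t ∈ Ioo (0 : ℝ) 1) :
    HasDerivAt (fun r => ∫ s in (0 : ℝ)..1, s ^ a * (1 - r * s) ^ b * (1 - s) ^ c)
      (∫ s in (0 : ℝ)..1, -b * (s ^ (a + 1) * (1 - t * s) ^ (b - 1) * (1 - s) ^ c)) t := by
  have hdiv : ∀ e : ℝ, ContinuousOn (fun s : ℝ => (1 - t * s) ^ e) (uIcc 0 1) := by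
    intro e
    rw [uIcc_of_le zero_le_one]
    refine ContinuousOn.rpow_const (by fun_prop) fun s hs => Or.inl ?_
    nlinarith [hs.1, hs.2, ht.1, ht.2]
  have hint : ∀ a' : ℝ, -1 < a' → ∀ e : ℝ,
      IntervalIntegrable (fun s : ℝ => s ^ a' * (1 - t * s) ^ e * (1 - s) ^ c) volume 0 1 := by
    intro a' ha' e
    refine ((intervalIntegrable_rpow_mul_sub_rpow ha' hc one_pos).mul_continuousOn
      (hdiv e)).congr fun s _ => ?_
    ring
  -- T keeps 1 - rs at least 1 - T > 0 for r near t. In the bound, the summand 1 covers b ≥ 1 and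
  -- (1-T)^(b-1) covers b ≤ 1.
  set T := (1 + t) / 2 with hT
  have hT1 : T < 1 := by linarith [ht.2]
  have htT : t < T := by linarith [ht.2]
  refine (hasDerivAt_integral_of_dominated_loc_of_deriv_le
    (F' := fun r s => -b * (s ^ (a + 1) * (1 - r * s) ^ (b - 1) * (1 - s) ^ c))
    (s := Ioo 0 T)
    (bound := fun s => |b| * (1 + (1 - T) ^ (b - 1)) * (s ^ (a + 1) * (1 - s) ^ c))
    (Ioo_mem_nhds ht.1 htT) ?_ (hint a ha b) ?_ ?_ ?_ ?_).2
  · refine Eventually.of_forall fun r => Measurable.aestronglyMeasurable (by fun_prop)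
  · exact Measurable.aestronglyMeasurable (by fun_prop)
  · refine Eventually.of_forall fun s hs r hr => ?_
    rw [uIoc_of_le zero_le_one] at hs
    have hs0 := hs.1
    have h1 : 0 ≤ 1 - s := by linarith [hs.2]
    have hrs : 1 - T ≤ 1 - r * s := by nlinarith [hr.1, hr.2, hs.2]
    have hrs' : 1 - r * s ≤ 1 := by nlinarith [hr.1]
    have hpos : 0 < 1 - T := by linarith
    have hle : (1 - r * s) ^ (b - 1) ≤ 1 + (1 - T) ^ (b - 1) := by
      rcases le_total 0 (b - 1) with hb | hb
      · have := Real.rpow_le_one (by linarith) hrs' hb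
        have := Real.rpow_nonneg hpos.le (b - 1)
        linarith
      · have := Real.rpow_le_rpow_of_nonpos hpos hrs hb
        linarith
    have p1 := Real.rpow_nonneg hs0.le (a + 1)
    have p2 := Real.rpow_nonneg h1 c
    have p3 := Real.rpow_nonneg (hpos.le.trans hrs) (b - 1)
    rw [Real.norm_eq_abs, abs_mul, abs_neg,
      abs_of_nonneg (mul_nonneg (mul_nonneg p1 p3) p2)]
    calc |b| * (s ^ (a + 1) * (1 - r * s) ^ (b - 1) * (1 - s) ^ c)
        = |b| * (1 - r * s) ^ (b - 1) * (s ^ (a + 1) * (1 - s) ^ c) := by ring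
      _ ≤ _ := by gcongr
  · exact (intervalIntegrable_rpow_mul_sub_rpow (by linarith) hc one_pos).const_mul _
  · refine Eventually.of_forall fun s hs r hr => ?_
    rw [uIoc_of_le zero_le_one] at hs
    have hrs : 1 - r * s ≠ 0 := by nlinarith [hr.1, hr.2, hs.2, hs.1]
    have d := ((((hasDerivAt_id r).mul_const s).const_sub 1).rpow_const (p := b)
      (Or.inl hrs)).const_mul (s ^ a) |>.mul_const ((1 - s) ^ c)
    refine d.congr_deriv ?_
    rw [Real.rpow_add hs.1, Real.rpow_one]
    simp only [id]
    ring

/-- For c < 1 the formal derivative of the integrand is unbounded at the moving endpoint. The scaled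
form is differentiated instead, and integration by parts with contiguity in c brings the result back
to the expected shape. -/
theorem hasDerivAt_partialInt {a c : ℝ} (ha : -1 < a) (b : ℝ) (hc : 0 < c) {t : ℝ}
    (ht : t ∈ Ioo (0 : ℝ) 1) :
    HasDerivAt (partialInt a b c) (c * partialInt a b (c - 1) t) t := by
  have ht0 := ht.1
  have d := ((hasDerivAt_id t).rpow_const (p := a + c + 1) (Or.inl ht0.ne')).mul
    (hasDerivAt_scaledInt ha b (c := c) (by linarith) ht)
  have e : partialInt a b c =ᶠ[𝓝 t] fun r =>
      r ^ (a + c + 1) * ∫ s in (0 : ℝ)..1, s ^ a * (1 - r * s) ^ b * (1 - s) ^ c := by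
    filter_upwards [Ioi_mem_nhds ht0] with r hr using partialInt_scale hr
  refine (d.congr_of_eventuallyEq e).congr_deriv ?_
  have s1 := partialInt_scale (a := a) (b := b) (c := c) ht0
  have s2 := partialInt_scale (a := a + 1) (b := b - 1) (c := c) ht0
  have r1 := partialInt_by_parts (a := a + 1) (by linarith) b hc ht
  have r2 := partialInt_add_one_right (c := c - 1) ha b (by linarith) ht
  rw [sub_add_cancel] at r2
  rw [add_sub_cancel_right] at r1
  rw [intervalIntegral.integral_const_mul]
  simp only [id, one_mul, add_sub_cancel_right]
  rw [Real.rpow_add ht0, Real.rpow_one] at s1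
  rw [show a + 1 + c + 1 = a + c + 1 + 1 by ring, Real.rpow_add ht0, Real.rpow_add ht0,
    Real.rpow_one] at s2
  rw [Real.rpow_add ht0 (a + c), Real.rpow_one]
  refine mul_left_cancel₀ ht0.ne' ?_
  linear_combination (-(a + c + 1)) * s1 + b * s2 + r1 + c * r2

end DegenerateJacobi

/-! ### Two-sided integrals with a jump at t -/

namespace DegenerateJacobi

open MeasureTheory Set Filter Topology intervalIntegral

/-- The integral over `[0, 1]` of `x ^ a (1 - x) ^ b |x - t| ^ c`, weighted by `A` to the left of `t`
and by `C` to the right of `t`. -/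
noncomputable def splitInt (A C a b c t : ℝ) : ℝ :=
  A * partialInt a b c t + C * partialInt b a c (1 - t)

theorem one_sub_mem_Ioo {t : ℝ} (ht : t ∈ Ioo (0 : ℝ) 1) : 1 - t ∈ Ioo (0 : ℝ) 1 :=
  ⟨by linarith [ht.2], by linarith [ht.1]⟩

section

variable {A C a b c t : ℝ}

theorem splitInt_add_one_left (ha : -1 < a) (hb : -1 < b) (hc : -1 < c)
    (ht : t ∈ Ioo (0 : ℝ) 1) :
    splitInt A C (a + 1) b c t + splitInt A C a (b + 1) c t = splitInt A C a b c t := by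
  unfold splitInt
  linear_combination A * partialInt_add_one_left ha b hc ht
    + C * partialInt_add_one_left hb a hc (one_sub_mem_Ioo ht)

/-- Multiplication by x - t raises the power of |x - t| and flips the sign to the left of t, whence
-A. -/
theorem splitInt_sub_mul (ha : -1 < a) (hb : -1 < b) (hc : -1 < c) (ht : t ∈ Ioo (0 : ℝ) 1) :
    splitInt A C (a + 1) b c t - t * splitInt A C a b c t = splitInt (-A) C a b (c + 1) t := by
  unfold splitInt
  linear_combination A * partialInt_add_one_right ha b hc ht
    + C * partialInt_add_one_left hb a hc (one_sub_mem_Ioo ht)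
    - C * partialInt_add_one_right hb a hc (one_sub_mem_Ioo ht)

theorem splitInt_by_parts (ha : 0 < a) (hb : 0 < b) (hc : 0 < c) (ht : t ∈ Ioo (0 : ℝ) 1) :
    a * splitInt A C (a - 1) b c t - b * splitInt A C a (b - 1) c t
      + c * splitInt (-A) C a b (c - 1) t = 0 := by
  unfold splitInt
  linear_combination A * partialInt_by_parts ha b hc ht
    - C * partialInt_by_parts hb a hc (one_sub_mem_Ioo ht)

theorem hasDerivAt_splitInt (ha : -1 < a) (hb : -1 < b) (hc : 0 < c) (ht : t ∈ Ioo (0 : ℝ) 1) :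
    HasDerivAt (splitInt A C a b c) (-c * splitInt (-A) C a b (c - 1) t) t := by
  have h1 := (hasDerivAt_partialInt ha b hc ht).const_mul A
  have h2 := ((hasDerivAt_partialInt hb a hc (one_sub_mem_Ioo ht)).comp t
    ((hasDerivAt_id t).const_sub 1)).const_mul C
  refine (h1.add h2).congr_deriv ?_
  unfold splitInt
  ring

end

/-! ### Moments of the weight and positivity of the Hankel determinant -/

section

variable {α β γ A B : ℝ}

theorem weight_eq (t x : ℝ) : weight α β γ A B t x
    = A * (x ^ α * (1 - x) ^ β * |x - t| ^ γ)
      + B * (Ioi t).indicator (fun x => x ^ α * (1 - x) ^ β * |x - t| ^ γ) x := by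
  unfold weight heaviside
  by_cases h : t < x
  · simp [h]; ring
  · simp [h]; ring

theorem intervalIntegrable_mul_weight (hα : 0 < α) (hβ : 0 < β) (hγ : 0 < γ) {f : ℝ → ℝ}
    (hf : Continuous f) (t u v : ℝ) :
    IntervalIntegrable (fun x => f x * weight α β γ A B t x) volume u v := by
  have hc : Continuous fun x : ℝ => f x * (x ^ α * (1 - x) ^ β * |x - t| ^ γ) := by
    refine hf.mul (Continuous.mul (Continuous.mul ?_ ?_) ?_)
    · exact continuous_id.rpow_const fun _ => Or.inr hα.le
    · exact Continuous.rpow_const (by fun_prop) fun _ => Or.inr hβ.le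
    · exact Continuous.rpow_const (by fun_prop) fun _ => Or.inr hγ.le
  have hi : IntervalIntegrable
      ((Ioi t).indicator fun x : ℝ => f x * (x ^ α * (1 - x) ^ β * |x - t| ^ γ)) volume u v := by
    have := hc.intervalIntegrable (μ := volume) u v
    rw [intervalIntegrable_iff] at this ⊢
    exact this.indicator measurableSet_Ioi
  refine (((hc.intervalIntegrable u v).const_mul A).add (hi.const_mul B)).congr fun x _ => ?_
  simp only [weight_eq, indicator]
  split_ifs <;> ring

theorem moment_eq_splitInt (hα : 0 < α) (hβ : 0 < β) (hγ : 0 < γ) (k : ℕ) {t : ℝ}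
    (ht : t ∈ Ioo (0 : ℝ) 1) :
    moment α β γ A B k t = splitInt A (A + B) (α + k) β γ t := by
  have hk : ∀ u v, IntervalIntegrable (fun x => x ^ k * weight α β γ A B t x) volume u v :=
    fun u v => intervalIntegrable_mul_weight hα hβ hγ (continuous_pow k) t u v
  rw [moment, ← integral_add_adjacent_intervals (hk 0 t) (hk t 1), splitInt, partialInt,
    partialInt]
  congr 1
  · rw [← intervalIntegral.integral_const_mul]
    refine integral_congr_Ioo_of_le ht.1.le fun x hx => ?_
    have h1 : |x - t| = t - x := by rw [abs_of_neg (by linarith [hx.2])]; ring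
    have h2 : ¬ t < x := by linarith [hx.2]
    simp only [weight, heaviside, h1, sub_pos, h2, if_false, Real.rpow_add hx.1,
      Real.rpow_natCast]
    ring
  · have h := integral_comp_sub_left (a := 0) (b := 1 - t)
      (fun x => x ^ k * weight α β γ A B t x) 1
    rw [sub_sub_cancel, sub_zero] at h
    rw [← h, ← intervalIntegral.integral_const_mul]
    refine integral_congr_Ioo_of_le (by linarith [ht.2]) fun x hx => ?_
    have h0 : 0 < 1 - x := by linarith [hx.2, ht.1]
    have h1 : |1 - x - t| = 1 - t - x := by rw [abs_of_pos (by linarith [hx.2])]; ring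
    have h2 : t < 1 - x := by linarith [hx.2]
    simp only [weight, heaviside, h1, sub_pos, h2, if_true, Real.rpow_add h0,
      Real.rpow_natCast, sub_sub_cancel]
    ring

theorem weight_nonneg (hA : 0 ≤ A) (hAB : 0 ≤ A + B) (t : ℝ) {x : ℝ} (hx : x ∈ Icc (0 : ℝ) 1) :
    0 ≤ weight α β γ A B t x := by
  have h1 := Real.rpow_nonneg hx.1 α
  have h2 := Real.rpow_nonneg (sub_nonneg.2 hx.2) β
  have h3 := Real.rpow_nonneg (abs_nonneg (x - t)) γ
  unfold weight heaviside
  split_ifs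
  · rw [mul_one]; positivity
  · rw [mul_zero, add_zero]; positivity

theorem exists_Ioo_weight_pos (hA : 0 ≤ A) (hAB : 0 ≤ A + B) (hne : ¬ (A = 0 ∧ B = 0)) {t : ℝ}
    (ht : t ∈ Ioo (0 : ℝ) 1) :
    ∃ u v, u < v ∧ Ioo u v ⊆ Ioo 0 1 ∧ ∀ x ∈ Ioo u v, 0 < weight α β γ A B t x := by
  have key : ∀ x ∈ Ioo (0 : ℝ) 1, x ≠ t → 0 < A + B * heaviside (x - t) →
      0 < weight α β γ A B t x := by
    intro x hx hxt h
    have h1 := Real.rpow_pos_of_pos hx.1 α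
    have h2 := Real.rpow_pos_of_pos (sub_pos.2 hx.2) β
    have h3 := Real.rpow_pos_of_pos (abs_pos.2 (sub_ne_zero.2 hxt)) γ
    unfold weight
    positivity
  rcases hA.eq_or_lt with hA0 | hA0
  · refine ⟨t, 1, ht.2, Ioo_subset_Ioo_left ht.1.le, fun x hx =>
      key x ⟨ht.1.trans hx.1, hx.2⟩ hx.1.ne' ?_⟩
    have hB : B ≠ 0 := fun h => hne ⟨hA0.symm, h⟩
    have : 0 < A + B := lt_of_le_of_ne hAB fun h => hB (by linarith)
    simpa [heaviside, hx.1] using this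
  · refine ⟨0, t, ht.1, Ioo_subset_Ioo_right ht.2.le, fun x hx =>
      key x ⟨hx.1, hx.2.trans ht.2⟩ hx.2.ne ?_⟩
    have : ¬ t < x := not_lt.2 hx.2.le
    simpa [heaviside, this] using hA0

open Polynomial in
theorem integral_sq_mul_weight_pos (hα : 0 < α) (hβ : 0 < β) (hγ : 0 < γ) (hA : 0 ≤ A)
    (hAB : 0 ≤ A + B) (hne : ¬ (A = 0 ∧ B = 0)) {t : ℝ} (ht : t ∈ Ioo (0 : ℝ) 1) {p : ℝ[X]}
    (hp : p ≠ 0) : 0 < ∫ x in (0 : ℝ)..1, p.eval x ^ 2 * weight α β γ A B t x := by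
  have hint := intervalIntegrable_mul_weight (A := A) (B := B) hα hβ hγ
    (f := fun x => p.eval x ^ 2) (by fun_prop) t 0 1
  rw [integral_of_le zero_le_one]
  rw [intervalIntegrable_iff_integrableOn_Ioc_of_le zero_le_one] at hint
  rw [setIntegral_pos_iff_support_of_nonneg_ae _ hint]
  · obtain ⟨u, v, huv, hsub, hpos⟩ := exists_Ioo_weight_pos (α := α) (β := β) (γ := γ)
      hA hAB hne ht
    have hfin : (p.rootSet ℝ).Finite := p.rootSet_finite ℝ
    have hle : Ioo u v \ p.rootSet ℝ ⊆
        Function.support (fun x => p.eval x ^ 2 * weight α β γ A B t x) ∩ Ioc 0 1 := by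
      rintro x ⟨hx, hr⟩
      refine ⟨?_, Ioo_subset_Ioc_self (hsub hx)⟩
      have : p.eval x ≠ 0 := fun h => hr (by
        rw [mem_rootSet_of_ne hp]; simpa using h)
      exact mul_ne_zero (pow_ne_zero 2 this) (hpos x hx).ne'
    refine lt_of_lt_of_le ?_ (measure_mono hle)
    rw [measure_sdiff_null (hfin.measure_zero _)]
    simpa using huv
  · filter_upwards [ae_restrict_mem measurableSet_Ioc] with x hx
    exact mul_nonneg (sq_nonneg _) (weight_nonneg hA hAB t (Ioc_subset_Icc_self hx))

open Polynomial in
-- The quadratic form at c is the integral of p² w, where p has coefficients c.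
theorem posDef_hankel (hα : 0 < α) (hβ : 0 < β) (hγ : 0 < γ) (hA : 0 ≤ A)
    (hAB : 0 ≤ A + B) (hne : ¬ (A = 0 ∧ B = 0)) (n : ℕ) {t : ℝ} (ht : t ∈ Ioo (0 : ℝ) 1) :
    (Matrix.of fun i j : Fin n => moment α β γ A B ((i : ℕ) + (j : ℕ)) t).PosDef := by
  refine Matrix.PosDef.of_dotProduct_mulVec_pos ?_ fun c hc => ?_
  · ext i j
    simp [add_comm]
  · set p : ℝ[X] := ∑ i : Fin n, C (c i) * X ^ (i : ℕ) with hp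
    have hp0 : p ≠ 0 := by
      intro h
      refine hc (funext fun i => ?_)
      have := congrArg (fun q => coeff q (i : ℕ)) h
      simpa [hp, finsetSum_coeff, coeff_X_pow, Fin.val_inj] using this
    refine (integral_sq_mul_weight_pos hα hβ hγ hA hAB hne ht hp0).trans_eq ?_
    have e : ∀ x, p.eval x ^ 2 * weight α β γ A B t x
        = ∑ i : Fin n, ∑ j : Fin n,
          c i * c j * (x ^ ((i : ℕ) + (j : ℕ)) * weight α β γ A B t x) := by
      intro x
      simp only [hp, eval_finsetSum, eval_mul, eval_C, eval_pow, eval_X]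
      rw [sq, Finset.sum_mul_sum, Finset.sum_mul]
      refine Finset.sum_congr rfl fun i _ => ?_
      rw [Finset.sum_mul]
      refine Finset.sum_congr rfl fun j _ => ?_
      ring
    have hi : ∀ i j : Fin n, IntervalIntegrable (fun x =>
        c i * c j * (x ^ ((i : ℕ) + (j : ℕ)) * weight α β γ A B t x)) volume 0 1 := fun i j =>
      (intervalIntegrable_mul_weight hα hβ hγ (continuous_pow _) t 0 1).const_mul _
    simp only [e]
    rw [intervalIntegral.integral_finsetSum fun i _ =>
      (IntervalIntegrable.sum Finset.univ fun j _ => hi i j).congr fun x _ => by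
        rw [Finset.sum_apply]]
    simp only [dotProduct, Matrix.mulVec, Finset.mul_sum, Matrix.of_apply]
    refine Finset.sum_congr rfl fun i _ => ?_
    rw [intervalIntegral.integral_finsetSum fun j _ => hi i j]
    refine Finset.sum_congr rfl fun j _ => ?_
    rw [intervalIntegral.integral_const_mul, ← moment]
    simp
    ring

theorem hankelDet_pos (hα : 0 < α) (hβ : 0 < β) (hγ : 0 < γ) (hA : 0 ≤ A)
    (hAB : 0 ≤ A + B) (hne : ¬ (A = 0 ∧ B = 0)) (n : ℕ) {t : ℝ} (ht : t ∈ Ioo (0 : ℝ) 1) :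
    0 < hankelDet α β γ A B n t :=
  (posDef_hankel hα hβ hγ hA hAB hne n ht).det_pos

end

end DegenerateJacobi

/-! ### Orthogonal polynomials for a functional, residues, and the algebraic σ-form -/

namespace DegenerateJacobi

open Polynomial

/-- The linear functional on polynomials with moments `μ`. -/
noncomputable def momentFunctional (μ : ℕ → ℝ) : ℝ[X] →ₗ[ℝ] ℝ :=
  Polynomial.lsum fun k => μ k • LinearMap.id

@[simp]
theorem momentFunctional_C_mul_X_pow (μ : ℕ → ℝ) (k : ℕ) (a : ℝ) :
    momentFunctional μ (C a * X ^ k) = a * μ k := by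
  rw [momentFunctional, lsum_apply, C_mul_X_pow_eq_monomial, sum_monomial_index] <;>
    simp [mul_comm]

theorem momentFunctional_ext {f g : ℝ[X] →ₗ[ℝ] ℝ} (h : ∀ k, f (X ^ k) = g (X ^ k)) : f = g := by
  refine Polynomial.lhom_ext' fun k => LinearMap.ext_ring ?_
  simpa [← X_pow_eq_monomial] using h k

/-- Orthogonality data of size `m + 1` for the functional `L`. -/
structure IsOrthogonalPair (L : ℝ[X] →ₗ[ℝ] ℝ) (m : ℕ) (P Q : ℝ[X]) : Prop where
  monic : P.coeff (m + 1) = 1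
  natDegree_left : P.natDegree ≤ m + 1
  natDegree_right : Q.natDegree ≤ m
  left : ∀ q : ℝ[X], q.natDegree ≤ m → L (P * q) = 0
  right : ∀ q : ℝ[X], q.natDegree ≤ m → L (Q * q) = q.coeff m

/-- `f` is obtained from `L` by dividing by `X - c`. -/
def IsDivided (L f : ℝ[X] →ₗ[ℝ] ℝ) (c : ℝ) : Prop :=
  ∀ p : ℝ[X], f ((X - C c) * p) = L p

theorem exists_eq_eval_add (p : ℝ[X]) (c : ℝ) {m : ℕ} (hp : p.natDegree ≤ m + 1) :
    ∃ q : ℝ[X], p = C (p.eval c) + (X - C c) * q ∧ q.natDegree ≤ m ∧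
      q.coeff m = p.coeff (m + 1) := by
  have h := modByMonic_add_div p (X - C c)
  rw [modByMonic_X_sub_C_eq_C_eval] at h
  have hd : (p /ₘ (X - C c)).natDegree ≤ m := by
    rw [natDegree_divByMonic _ (monic_X_sub_C c), natDegree_X_sub_C]
    omega
  refine ⟨p /ₘ (X - C c), h.symm, hd, ?_⟩
  have h2 := congrArg (fun q => coeff q (m + 1)) h
  have h3 : (p /ₘ (X - C c)).coeff (m + 1) = 0 :=
    coeff_eq_zero_of_natDegree_lt (by omega)
  simpa [sub_mul, coeff_X_mul, coeff_C, h3] using h2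

namespace IsOrthogonalPair

variable {L f : ℝ[X] →ₗ[ℝ] ℝ} {m : ℕ} {P Q : ℝ[X]} {c : ℝ}

/-- Dividing p by X - c leaves p(c) plus (X - c)q; on the second part f becomes L, and orthogonality
kills it. For Q the same division picks up the top coefficient of p. -/
theorem divided_left_mul (h : IsOrthogonalPair L m P Q) (hf : IsDivided L f c) {p : ℝ[X]}
    (hp : p.natDegree ≤ m + 1) : f (P * p) = p.eval c * f P := by
  obtain ⟨q, hq, hqd, -⟩ := exists_eq_eval_add p c hp
  have e : P * p = p.eval c • P + (X - C c) * (P * q) := by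
    conv_lhs => rw [hq]
    rw [smul_eq_C_mul]
    ring
  rw [e, map_add, map_smul, hf, h.left q hqd, smul_eq_mul, add_zero]

theorem divided_right_mul (h : IsOrthogonalPair L m P Q) (hf : IsDivided L f c) {p : ℝ[X]}
    (hp : p.natDegree ≤ m + 1) : f (Q * p) = p.eval c * f Q + p.coeff (m + 1) := by
  obtain ⟨q, hq, hqd, hqc⟩ := exists_eq_eval_add p c hp
  have e : Q * p = p.eval c • Q + (X - C c) * (Q * q) := by
    conv_lhs => rw [hq]
    rw [smul_eq_C_mul]
    ring
  rw [e, map_add, map_smul, hf, h.right q hqd, smul_eq_mul, hqc]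

/-- The Wronskian-type relation between values and functions of the second kind. -/
theorem wronskian (h : IsOrthogonalPair L m P Q) (hf : IsDivided L f c) :
    Q.eval c * f P = P.eval c * f Q + 1 := by
  rw [← h.divided_left_mul hf (h.natDegree_right.trans (Nat.le_succ m)), mul_comm,
    h.divided_right_mul hf h.natDegree_left, h.monic]

theorem divided_right_mul_self (h : IsOrthogonalPair L m P Q) (hf : IsDivided L f c) :
    f (Q * Q) = Q.eval c * f Q := by
  rw [h.divided_right_mul hf (h.natDegree_right.trans (Nat.le_succ m)),
    coeff_eq_zero_of_natDegree_lt (Nat.lt_succ_of_le h.natDegree_right), add_zero]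

theorem divided_left_mul_self (h : IsOrthogonalPair L m P Q) (hf : IsDivided L f c) :
    f (P * P) = P.eval c * f P :=
  h.divided_left_mul hf h.natDegree_left

theorem divided_left_mul_right (h : IsOrthogonalPair L m P Q) (hf : IsDivided L f c) :
    f (P * Q) = Q.eval c * f P :=
  h.divided_left_mul hf (h.natDegree_right.trans (Nat.le_succ m))

end IsOrthogonalPair

/-- Pearson's relation for a weight with logarithmic derivative
`α / x + β / (x - 1) + γ / (x - t)`. -/
structure IsPearson (α β γ t : ℝ) (L f₀ f₁ f : ℝ[X] →ₗ[ℝ] ℝ) : Prop where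
  zero : IsDivided L f₀ 0
  one : IsDivided L f₁ 1
  pole : IsDivided L f t
  pearson : ∀ p : ℝ[X], L (derivative p) + α * f₀ p + β * f₁ p + γ * f p = 0

section

variable {α β γ t : ℝ} {L f₀ f₁ f : ℝ[X] →ₗ[ℝ] ℝ} {m : ℕ} {P Q : ℝ[X]}

theorem coeff_derivative_top (p : ℝ[X]) (m : ℕ) :
    (derivative p).coeff m = (m + 1) * p.coeff (m + 1) := by
  rw [coeff_derivative, mul_comm]

theorem natDegree_derivative_le_pred {p : ℝ[X]} (hp : p.natDegree ≤ m + 1) :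
    (derivative p).natDegree ≤ m :=
  (natDegree_derivative_le p).trans (by omega)

/-- Pearson's relation for P²; P' has degree at most m, so the derivative term vanishes. The next
two lemmas use Q² and PQ, where only L(P'Q) = m + 1 survives. -/
theorem pearson_left_left (hw : IsPearson α β γ t L f₀ f₁ f) (h : IsOrthogonalPair L m P Q) :
    α * (P.eval 0 * f₀ P) + β * (P.eval 1 * f₁ P) + γ * (P.eval t * f P) = 0 := by
  have e := hw.pearson (P * P)
  rw [derivative_mul, mul_comm (derivative P), map_add,
    h.left _ (natDegree_derivative_le_pred h.natDegree_left), h.divided_left_mul_self hw.zero,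
    h.divided_left_mul_self hw.one, h.divided_left_mul_self hw.pole] at e
  linarith

theorem pearson_right_right (hw : IsPearson α β γ t L f₀ f₁ f) (h : IsOrthogonalPair L m P Q) :
    α * (Q.eval 0 * f₀ Q) + β * (Q.eval 1 * f₁ Q) + γ * (Q.eval t * f Q) = 0 := by
  have hQ := h.natDegree_right.trans (Nat.le_succ m)
  have e := hw.pearson (Q * Q)
  rw [derivative_mul, mul_comm (derivative Q), map_add,
    h.right _ (natDegree_derivative_le_pred hQ), coeff_derivative_top,
    coeff_eq_zero_of_natDegree_lt (Nat.lt_succ_of_le h.natDegree_right),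
    h.divided_right_mul_self hw.zero,
    h.divided_right_mul_self hw.one, h.divided_right_mul_self hw.pole] at e
  linarith

theorem pearson_left_right (hw : IsPearson α β γ t L f₀ f₁ f) (h : IsOrthogonalPair L m P Q) :
    (m + 1) + α * (Q.eval 0 * f₀ P) + β * (Q.eval 1 * f₁ P) + γ * (Q.eval t * f P) = 0 := by
  have hQ := h.natDegree_right.trans (Nat.le_succ m)
  have e := hw.pearson (P * Q)
  rw [derivative_mul, mul_comm (derivative P), map_add,
    h.right _ (natDegree_derivative_le_pred h.natDegree_left), coeff_derivative_top, h.monic,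
    h.left _ (natDegree_derivative_le_pred hQ),
    h.divided_left_mul_right hw.zero,
    h.divided_left_mul_right hw.one, h.divided_left_mul_right hw.pole] at e
  linarith

theorem natDegree_X_mul_derivative_le {p : ℝ[X]} {k : ℕ} (hp : p.natDegree ≤ k) :
    (X * derivative p).natDegree ≤ k := by
  rw [natDegree_le_iff_coeff_eq_zero]
  rintro (_ | j) hj
  · simp
  · rw [coeff_X_mul, coeff_derivative, coeff_eq_zero_of_natDegree_lt (hp.trans_lt hj), zero_mul]

/-- Pearson's relation for xPQ. The factor x removes the pole at 0, and XP' - (m+1)P has lost its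
leading term and has coefficient -P.coeff m at degree m. -/
theorem pearson_X_left_right (hw : IsPearson α β γ t L f₀ f₁ f) (h : IsOrthogonalPair L m P Q) :
    P.coeff m = β * (Q.eval 1 * f₁ P) + γ * t * (Q.eval t * f P) := by
  have hQ := h.natDegree_right.trans (Nat.le_succ m)
  have e := hw.pearson (X * (P * Q))
  have hPQ : L (P * Q) = 0 := h.left _ h.natDegree_right
  have hd : ∀ {g : ℝ[X] →ₗ[ℝ] ℝ} {c : ℝ}, IsDivided L g c →
      g (X * (P * Q)) = c * (Q.eval c * g P) := by
    intro g c hg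
    have : X * (P * Q) = (X - C c) * (P * Q) + c • (P * Q) := by
      rw [smul_eq_C_mul]; ring
    rw [this, map_add, hg, hPQ, map_smul, h.divided_left_mul_right hg, smul_eq_mul, zero_add]
  have hX : derivative (X * (P * Q))
      = P * Q + P * (X * derivative Q) + Q * (X * derivative P - (m + 1 : ℝ) • P)
        + (m + 1 : ℝ) • (P * Q) := by
    rw [derivative_mul, derivative_X, derivative_mul, smul_eq_C_mul, smul_eq_C_mul]
    ring
  have hdeg : (X * derivative P - (m + 1 : ℝ) • P).natDegree ≤ m := by
    have h1 : (X * derivative P - (m + 1 : ℝ) • P).natDegree ≤ m + 1 :=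
      (natDegree_sub_le_of_le (natDegree_X_mul_derivative_le h.natDegree_left)
        ((natDegree_smul_le _ _).trans h.natDegree_left)).trans_eq (max_self _)
    rw [natDegree_le_iff_coeff_eq_zero] at h1 ⊢
    intro j hj
    rcases (Nat.succ_le_of_lt hj).eq_or_lt with rfl | hj'
    · simp [coeff_X_mul, coeff_derivative, h.monic]
    · exact h1 j hj'
  have hc : (X * derivative P - (m + 1 : ℝ) • P).coeff m = -P.coeff m := by
    rcases m with _ | m
    · simp
    · simp [coeff_X_mul, coeff_derivative]
      ring
  rw [hX, hd hw.zero, hd hw.one, hd hw.pole, map_add, map_add, map_add, map_smul, hPQ,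
    h.left _ (natDegree_X_mul_derivative_le h.natDegree_right), h.right _ hdeg, hc,
    smul_zero] at e
  linarith

/-- The Christoffel-Darboux formula. -/
theorem christoffel_darboux (h : IsOrthogonalPair L m P Q)
    (huniq : ∀ p : ℝ[X], p.natDegree ≤ m → (∀ q : ℝ[X], q.natDegree ≤ m → L (p * q) = 0) → p = 0)
    {K : ℝ[X]} (hK : K.natDegree ≤ m)
    (hKL : ∀ q : ℝ[X], q.natDegree ≤ m → L (K * q) = q.eval t) :
    K.coeff m = Q.eval t ∧ (X - C t) * K = Q.eval t • P - P.eval t • Q := by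
  have hKm : K.coeff m = Q.eval t := by
    rw [← hKL Q h.natDegree_right, mul_comm, h.right K hK]
  refine ⟨hKm, sub_eq_zero.1 (huniq _ ?_ fun q hq => ?_)⟩
  · have hK' : K.coeff (m + 1) = 0 :=
      coeff_eq_zero_of_natDegree_lt (Nat.lt_succ_of_le hK)
    have hQ' : Q.coeff (m + 1) = 0 :=
      coeff_eq_zero_of_natDegree_lt (Nat.lt_succ_of_le h.natDegree_right)
    rw [natDegree_le_iff_coeff_eq_zero]
    intro j hj
    obtain ⟨i, rfl⟩ := Nat.exists_eq_add_of_le hj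
    rcases i with _ | i
    · simp [sub_mul, coeff_X_mul, hK', hQ', hKm, h.monic]
    · have z : ∀ {p : ℝ[X]}, p.natDegree ≤ m + 1 → p.coeff (m.succ + (i + 1)) = 0 := fun hp =>
        coeff_eq_zero_of_natDegree_lt (by omega)
      have z' : K.coeff (m + 1 + i) = 0 := coeff_eq_zero_of_natDegree_lt (by omega)
      have zK := z (hK.trans (Nat.le_succ m))
      have zQ := z (h.natDegree_right.trans (Nat.le_succ m))
      have zP := z h.natDegree_left
      rw [← add_assoc] at zK zQ zP ⊢
      simp [sub_mul, coeff_X_mul, z', zK, zQ, zP]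
  · have hr : ((X - C t) * q - q.coeff m • P).natDegree ≤ m := by
      have hq' : q.coeff (m + 1) = 0 := coeff_eq_zero_of_natDegree_lt (Nat.lt_succ_of_le hq)
      rw [natDegree_le_iff_coeff_eq_zero]
      intro j hj
      obtain ⟨i, rfl⟩ := Nat.exists_eq_add_of_le hj
      rcases i with _ | i
      · simp [sub_mul, coeff_X_mul, hq', h.monic]
      · have z' : q.coeff (m + 1 + i) = 0 := coeff_eq_zero_of_natDegree_lt (by omega)
        have zq : q.coeff (m + 1 + (i + 1)) = 0 := coeff_eq_zero_of_natDegree_lt (by omega)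
        have hP := h.natDegree_left
        have zP : P.coeff (m + 1 + (i + 1)) = 0 := coeff_eq_zero_of_natDegree_lt (by omega)
        rw [Nat.succ_eq_add_one, ← add_assoc] at *
        simp [sub_mul, coeff_X_mul, z', zq, zP]
    have e : ((X - C t) * K - (Q.eval t • P - P.eval t • Q)) * q
        = K * ((X - C t) * q - q.coeff m • P) + q.coeff m • (P * K)
          - Q.eval t • (P * q) + P.eval t • (Q * q) := by
      simp only [smul_eq_C_mul]
      ring
    rw [e, map_add, map_sub, map_add, hKL _ hr, map_smul, map_smul, map_smul, h.left K hK,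
      h.left q hq, h.right q hq]
    simp
    ring

/-- The discriminant form of the relations between the three residues. -/
theorem residue_relation (hw : IsPearson α β γ t L f₀ f₁ f) (h : IsOrthogonalPair L m P Q)
    {p g N W : ℝ} (hp : P.coeff m = p) (hg : γ * (Q.eval t * f P) = g)
    (hN : (m + 1 : ℝ) = N)
    (hW : W = P.eval t * f P * (Q.eval 0 * f₀ Q) - P.eval 0 * f₀ P * (Q.eval t * f Q)) :
    α * (Q.eval 0 * f₀ P) = (t - 1) * g - N - p ∧
    (α * γ * W) ^ 2
      = ((p - t * g) * (p - t * g - β)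
          - ((t - 1) * g - N - p) * ((t - 1) * g - N - p - α) - g * (g - γ)) ^ 2
        - 4 * (((t - 1) * g - N - p) * ((t - 1) * g - N - p - α)) * (g * (g - γ)) := by
  have e1 := pearson_left_left hw h
  have e2 := pearson_right_right hw h
  have e3 := pearson_left_right hw h
  have e4 := pearson_X_left_right hw h
  have w0 := h.wronskian hw.zero
  have w1 := h.wronskian hw.one
  have wt := h.wronskian hw.pole
  set u0 := P.eval 0
  set u1 := P.eval 1
  set ut := P.eval t
  set v0 := Q.eval 0
  set v1 := Q.eval 1
  set vt := Q.eval t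
  have b0 : α * (v0 * f₀ P) = (t - 1) * g - N - p := by
    rw [← hp, ← hg, ← hN]
    linear_combination e3 + e4
  have b1 : β * (v1 * f₁ P) = p - t * g := by
    rw [← hp, ← hg]
    linear_combination -e4
  refine ⟨b0, ?_⟩
  have d0 : (α * (u0 * f₀ P)) * (α * (v0 * f₀ Q))
      = ((t - 1) * g - N - p) * ((t - 1) * g - N - p - α) := by
    rw [← b0]
    linear_combination -α ^ 2 * (v0 * f₀ P) * w0
  have d1 : (β * (u1 * f₁ P)) * (β * (v1 * f₁ Q)) = (p - t * g) * (p - t * g - β) := by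
    rw [← b1]
    linear_combination -β ^ 2 * (v1 * f₁ P) * w1
  have dt : (γ * (ut * f P)) * (γ * (vt * f Q)) = g * (g - γ) := by
    rw [← hg]
    linear_combination -γ ^ 2 * (vt * f P) * wt
  have hs : (γ * (ut * f P)) * (α * (v0 * f₀ Q)) + (α * (u0 * f₀ P)) * (γ * (vt * f Q))
      = (p - t * g) * (p - t * g - β)
          - ((t - 1) * g - N - p) * ((t - 1) * g - N - p - α) - g * (g - γ) := by
    rw [← d0, ← d1, ← dt]
    -- The P-entries and the Q-entries each sum to zero, so eliminating those at 1 gives the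
    -- symmetric cross term. The square of the antisymmetric one, W, is then (sum)² - 4(product).
    have x1 : β * (u1 * f₁ P) = -(α * (u0 * f₀ P)) - γ * (ut * f P) := by linarith
    have z1 : β * (v1 * f₁ Q) = -(α * (v0 * f₀ Q)) - γ * (vt * f Q) := by linarith
    rw [x1, z1]
    ring
  rw [← hs, ← d0, ← dt, hW]
  ring

end

/-- The algebraic identity behind the `σ`-form, in terms of the Painlevé parameters. -/
theorem sigma_form_identity (ν₁ ν₂ ν₃ ν₄ g b s τ R : ℝ) (hs : s = -((ν₃ + ν₄) * g) - ν₃ ^ 2)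
    (hτ : 2 * τ = 2 * (ν₃ + ν₄) * b + ν₁ * ν₂ + ν₃ * ν₄ - (ν₁ + ν₂) * (ν₃ + ν₄))
    (hR : R = (ν₃ + ν₄) ^ 2 * ((b * (b - (ν₁ + ν₂))
          - (-g - (ν₃ - ν₁) - b) * (-g - (ν₃ - ν₁) - b - (ν₁ - ν₂)) - g * (g - (ν₄ - ν₃))) ^ 2
        - 4 * ((-g - (ν₃ - ν₁) - b) * (-g - (ν₃ - ν₁) - b - (ν₁ - ν₂)))
          * (g * (g - (ν₄ - ν₃))))) :
    s * R + (2 * s * τ - s ^ 2 - ν₁ * ν₂ * ν₃ * ν₄) ^ 2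
      = (s + ν₁ ^ 2) * (s + ν₂ ^ 2) * (s + ν₃ ^ 2) * (s + ν₄ ^ 2) := by
  have e : 2 * s * τ = s * (2 * τ) := by ring
  rw [e, hτ, hR, hs]
  ring

/-- In the variables g and b = p - tg all explicit t disappears: σ' is affine in g, tσ' - σ is
affine in b, and the residue at 0 is -g - N - b. -/
theorem sigma_form_of_residues {N α β γ t p g S σ σ' : ℝ}
    (hσ : σ = -(2 * N + α + β + γ) * p - N * (N + α + γ) + N * γ * t
      + (-N * (N + α + β + γ) - (α + β) ^ 2 / 4) * t
      + 1 / 4 * (2 * N * (N + α + β + γ) + (α + β) * β - (α - β) * γ))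
    (hσ' : σ' = -(2 * N + α + β + γ) * g + N * γ
      + (-N * (N + α + β + γ) - (α + β) ^ 2 / 4))
    (hS : S ^ 2 = (2 * N + α + β + γ) ^ 2 * (((p - t * g) * (p - t * g - β)
          - ((t - 1) * g - N - p) * ((t - 1) * g - N - p - α) - g * (g - γ)) ^ 2
        - 4 * (((t - 1) * g - N - p) * ((t - 1) * g - N - p - α)) * (g * (g - γ)))) :
    σ' * S ^ 2 + (2 * σ' * (t * σ' - σ) - σ' ^ 2
        - (α + β) / 2 * ((β - α) / 2) * ((2 * N + α + β) / 2)
          * ((2 * N + α + β + 2 * γ) / 2)) ^ 2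
      = (σ' + ((α + β) / 2) ^ 2) * (σ' + ((β - α) / 2) ^ 2)
        * (σ' + ((2 * N + α + β) / 2) ^ 2) * (σ' + ((2 * N + α + β + 2 * γ) / 2) ^ 2) := by
  refine sigma_form_identity _ _ _ _ g (p - t * g) _ _ _ ?_ ?_ ?_
  · rw [hσ']; ring
  · rw [hσ, hσ']; ring
  · rw [hS]
    have h1 : (t - 1) * g - N - p
      = -g - ((2 * N + α + β) / 2 - (α + β) / 2) - (p - t * g) := by ring
    have h2 : (α + β) / 2 + (β - α) / 2 = β := by ring
    have h3 : (α + β) / 2 - (β - α) / 2 = α := by ring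
    have h4 : (2 * N + α + β + 2 * γ) / 2 - (2 * N + α + β) / 2 = γ := by ring
    have h5 : (2 * N + α + β) / 2 + (2 * N + α + β + 2 * γ) / 2 = 2 * N + α + β + γ := by ring
    rw [h1, h2, h3, h4, h5]

end DegenerateJacobi

/-! ### Determinants, linear systems and Hankel matrices -/

namespace DegenerateJacobi

open Polynomial Matrix

section

variable {ι : Type*} [Fintype ι] [DecidableEq ι]

/-- Jacobi's formula for the derivative of a determinant. -/
theorem hasDerivAt_det {A : ℝ → Matrix ι ι ℝ} {A' : Matrix ι ι ℝ} {t : ℝ}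
    (hA : ∀ i j, HasDerivAt (fun s => A s i j) (A' i j) t) :
    HasDerivAt (fun s => (A s).det) ((A t).adjugate * A').trace t := by
  have h : HasDerivAt (fun s => (A s).det)
      (∑ σ : Equiv.Perm ι, (Equiv.Perm.sign σ : ℤ) •
        ∑ i, (∏ j ∈ Finset.univ.erase i, A t (σ j) j) • A' (σ i) i) t := by
    simp only [det_apply]
    refine HasDerivAt.fun_sum fun σ _ => ?_
    have hp : HasDerivAt (fun s => ∏ i, A s (σ i) i)
        (∑ i, (∏ j ∈ Finset.univ.erase i, A t (σ j) j) • A' (σ i) i) t :=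
      HasDerivAt.fun_finsetProd fun i _ => hA (σ i) i
    simp only [Units.smul_def, zsmul_eq_mul]
    exact hp.const_mul _
  refine h.congr_deriv ?_
  simp only [Finset.smul_sum]
  rw [Finset.sum_comm]
  refine Finset.sum_congr rfl fun i _ => ?_
  have e : ((A t).adjugate * A') i i = ((A t).updateCol i fun k => A' k i).det := by
    rw [← cramer_apply, cramer_eq_adjugate_mulVec]
    rfl
  rw [diag_apply, e, det_apply]
  refine Finset.sum_congr rfl fun σ _ => ?_
  rw [← Finset.mul_prod_erase _ _ (Finset.mem_univ i), updateCol_self, Units.smul_def,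
    smul_eq_mul, mul_comm]
  congr 2
  exact Finset.prod_congr rfl fun j hj => (updateCol_ne (Finset.ne_of_mem_erase hj)).symm

theorem inv_mulVec_apply (A : Matrix ι ι ℝ) (b : ι → ℝ) (i : ι) :
    (A⁻¹ *ᵥ b) i = A.det⁻¹ * (A.updateCol i b).det := by
  rw [inv_def, smul_mulVec, ← cramer_eq_adjugate_mulVec, Pi.smul_apply, cramer_apply,
    Ring.inverse_eq_inv', smul_eq_mul]

/-- Cramer's rule gives differentiability of the solution c; differentiating A c = b then identifies
c' through A c' = b' - A' c. -/
theorem hasDerivAt_inv_mulVec {A : ℝ → Matrix ι ι ℝ} {A' : Matrix ι ι ℝ} {b : ℝ → ι → ℝ}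
    {b' : ι → ℝ} {t : ℝ} (hA : ∀ i j, HasDerivAt (fun s => A s i j) (A' i j) t)
    (hb : ∀ i, HasDerivAt (fun s => b s i) (b' i) t) (hdet : (A t).det ≠ 0) (i : ι) :
    HasDerivAt (fun s => ((A s)⁻¹ *ᵥ b s) i)
      (((A t)⁻¹ *ᵥ (b' - A' *ᵥ ((A t)⁻¹ *ᵥ b t))) i) t := by
  have hd := hasDerivAt_det hA
  have hc : ∀ i, DifferentiableAt ℝ (fun s => ((A s)⁻¹ *ᵥ b s) i) t := by
    intro i
    simp only [inv_mulVec_apply]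
    refine (hd.differentiableAt.inv hdet).mul ?_
    refine (hasDerivAt_det (A := fun s => (A s).updateCol i (b s)) (A' := A'.updateCol i b')
      fun k j => ?_).differentiableAt
    by_cases hj : j = i
    · subst hj
      simpa using hb k
    · simpa [hj] using hA k j
  set c' : ι → ℝ := fun i => deriv (fun s => ((A s)⁻¹ *ᵥ b s) i) t with hc'
  have hev : ∀ᶠ s in nhds t, (A s).det ≠ 0 := hd.continuousAt.eventually_ne hdet
  have key : A t *ᵥ c' = b' - A' *ᵥ ((A t)⁻¹ *ᵥ b t) := by
    funext k
    have h1 : HasDerivAt (fun s => ∑ j, A s k j * ((A s)⁻¹ *ᵥ b s) j)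
        (∑ j, (A' k j * ((A t)⁻¹ *ᵥ b t) j + A t k j * c' j)) t :=
      HasDerivAt.fun_sum fun j _ => (hA k j).mul (hc j).hasDerivAt
    have h2 : (fun s => ∑ j, A s k j * ((A s)⁻¹ *ᵥ b s) j) =ᶠ[nhds t] fun s => b s k := by
      filter_upwards [hev] with s hs
      change (A s *ᵥ ((A s)⁻¹ *ᵥ b s)) k = b s k
      rw [mulVec_mulVec, mul_nonsing_inv _ hs.isUnit, one_mulVec]
    have h3 := h1.unique ((hb k).congr_of_eventuallyEq h2)
    rw [Finset.sum_add_distrib] at h3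
    rw [Pi.sub_apply, ← h3]
    exact (add_sub_cancel_left _ _).symm
  have e : c' = (A t)⁻¹ *ᵥ (b' - A' *ᵥ ((A t)⁻¹ *ᵥ b t)) := by
    rw [← key, mulVec_mulVec, nonsing_inv_mul _ hdet.isUnit, one_mulVec]
  rw [← e]
  exact (hc i).hasDerivAt

end

/-- The polynomial with given coefficients. -/
noncomputable def ofCoeffs {m : ℕ} (c : Fin (m + 1) → ℝ) : ℝ[X] :=
  ∑ i, C (c i) * X ^ (i : ℕ)

section

variable {m : ℕ}

theorem coeff_ofCoeffs (c : Fin (m + 1) → ℝ) (i : Fin (m + 1)) :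
    (ofCoeffs c).coeff i = c i := by
  simp [ofCoeffs, coeff_X_pow, Fin.val_inj]

theorem natDegree_ofCoeffs_le (c : Fin (m + 1) → ℝ) : (ofCoeffs c).natDegree ≤ m :=
  natDegree_sum_le_of_forall_le _ _ fun i _ =>
    (natDegree_C_mul_X_pow_le _ _).trans (Nat.lt_succ_iff.1 i.2)

theorem eq_ofCoeffs {p : ℝ[X]} (hp : p.natDegree ≤ m) :
    p = ofCoeffs fun i : Fin (m + 1) => p.coeff i := by
  rw [ofCoeffs, Fin.sum_univ_eq_sum_range (fun i => C (p.coeff i) * X ^ i)]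
  exact p.as_sum_range_C_mul_X_pow' (Nat.lt_succ_of_le hp)

theorem eval_zero_ofCoeffs (c : Fin (m + 1) → ℝ) : (ofCoeffs c).eval 0 = c 0 := by
  rw [← coeff_zero_eq_eval_zero]
  exact coeff_ofCoeffs c 0

theorem momentFunctional_ofCoeffs_mul (μ : ℕ → ℝ) (c : Fin (m + 1) → ℝ) (k : ℕ) :
    momentFunctional μ (ofCoeffs c * X ^ k) = ∑ i, c i * μ (i + k) := by
  rw [ofCoeffs, Finset.sum_mul, map_sum]
  refine Finset.sum_congr rfl fun i _ => ?_
  rw [mul_assoc, ← pow_add, momentFunctional_C_mul_X_pow]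

theorem momentFunctional_X_pow (μ : ℕ → ℝ) (k : ℕ) : momentFunctional μ (X ^ k) = μ k := by
  simpa using momentFunctional_C_mul_X_pow μ k 1

theorem momentFunctional_ofCoeffs (μ : ℕ → ℝ) (c : Fin (m + 1) → ℝ) :
    momentFunctional μ (ofCoeffs c) = ∑ i, c i * μ i := by
  simpa using momentFunctional_ofCoeffs_mul μ c 0

/-- The Hankel matrix of size `m + 1`. -/
def hankel (μ : ℕ → ℝ) (m : ℕ) : Matrix (Fin (m + 1)) (Fin (m + 1)) ℝ :=
  Matrix.of fun i j => μ ((i : ℕ) + (j : ℕ))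

theorem hankel_apply (μ : ℕ → ℝ) (i j : Fin (m + 1)) : hankel μ m i j = μ (i + j) := rfl

theorem hankel_transpose (μ : ℕ → ℝ) : (hankel μ m)ᵀ = hankel μ m := by
  ext i j
  simp [hankel, add_comm]

theorem hankel_mulVec (μ : ℕ → ℝ) (c : Fin (m + 1) → ℝ) (i : Fin (m + 1)) :
    (hankel μ m *ᵥ c) i = momentFunctional μ (ofCoeffs c * X ^ (i : ℕ)) := by
  rw [momentFunctional_ofCoeffs_mul]
  change ∑ j, hankel μ m i j * c j = _
  refine Finset.sum_congr rfl fun j _ => ?_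
  rw [hankel_apply, mul_comm, add_comm]

variable {μ : ℕ → ℝ}

theorem momentFunctional_ofCoeffs_mul_of_natDegree_le (c : Fin (m + 1) → ℝ) {q : ℝ[X]}
    (hq : q.natDegree ≤ m) : momentFunctional μ (ofCoeffs c * q)
      = ∑ i : Fin (m + 1), q.coeff i * (hankel μ m *ᵥ c) i := by
  conv_lhs => rw [eq_ofCoeffs hq]
  have e : ofCoeffs c * ofCoeffs (fun i : Fin (m + 1) => q.coeff i)
      = ∑ i : Fin (m + 1), q.coeff i • (ofCoeffs c * X ^ (i : ℕ)) := by
    conv_lhs => enter [2]; rw [ofCoeffs]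
    rw [Finset.mul_sum]
    exact Finset.sum_congr rfl fun i _ => by rw [smul_eq_C_mul, mul_left_comm]
  rw [e, map_sum]
  refine Finset.sum_congr rfl fun j _ => ?_
  rw [hankel_mulVec, map_smul, smul_eq_mul]

/-- The polynomial of degree at most `m` with prescribed moments. -/
noncomputable def dualPoly (μ : ℕ → ℝ) {m : ℕ} (b : Fin (m + 1) → ℝ) : ℝ[X] :=
  ofCoeffs ((hankel μ m)⁻¹ *ᵥ b)

/-- The monic orthogonal polynomial of degree `m + 1`. -/
noncomputable def orthPoly (μ : ℕ → ℝ) (m : ℕ) : ℝ[X] :=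
  X ^ (m + 1) + dualPoly μ fun i : Fin (m + 1) => -μ (m + 1 + i)

theorem hankel_mulVec_inv (hdet : (hankel μ m).det ≠ 0)
    (b : Fin (m + 1) → ℝ) : hankel μ m *ᵥ ((hankel μ m)⁻¹ *ᵥ b) = b := by
  rw [mulVec_mulVec, mul_nonsing_inv _ hdet.isUnit, one_mulVec]

theorem momentFunctional_dualPoly_mul (hdet : (hankel μ m).det ≠ 0)
    (b : Fin (m + 1) → ℝ) {q : ℝ[X]} (hq : q.natDegree ≤ m) :
    momentFunctional μ (dualPoly μ b * q) = ∑ i : Fin (m + 1), q.coeff i * b i := by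
  rw [dualPoly, momentFunctional_ofCoeffs_mul_of_natDegree_le _ hq, hankel_mulVec_inv hdet]

theorem eq_zero_of_orthogonal (hdet : (hankel μ m).det ≠ 0)
    (p : ℝ[X]) (hp : p.natDegree ≤ m)
    (h : ∀ q : ℝ[X], q.natDegree ≤ m → momentFunctional μ (p * q) = 0) : p = 0 := by
  rw [eq_ofCoeffs hp] at h ⊢
  set c : Fin (m + 1) → ℝ := fun i => p.coeff i
  have hc : hankel μ m *ᵥ c = 0 := by
    funext i
    rw [hankel_mulVec]
    exact h _ ((natDegree_X_pow_le _).trans (Nat.lt_succ_iff.1 i.2))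
  have : c = 0 := by
    rw [← one_mulVec c, ← nonsing_inv_mul _ hdet.isUnit, ← mulVec_mulVec, hc, mulVec_zero]
  simp [this, ofCoeffs]

theorem isOrthogonalPair (hdet : (hankel μ m).det ≠ 0)
    : IsOrthogonalPair (momentFunctional μ) m (orthPoly μ m)
    (dualPoly μ (Pi.single (Fin.last m) 1)) where
  monic := by
    rw [orthPoly, coeff_add, coeff_X_pow_self, dualPoly, coeff_eq_zero_of_natDegree_lt
      (Nat.lt_succ_of_le (natDegree_ofCoeffs_le _)), add_zero]
  natDegree_left := (natDegree_add_le_of_le (natDegree_X_pow_le _)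
    ((natDegree_ofCoeffs_le _).trans (Nat.le_succ m))).trans_eq (max_self _)
  natDegree_right := natDegree_ofCoeffs_le _
  left q hq := by
    rw [orthPoly, add_mul, map_add, momentFunctional_dualPoly_mul hdet _ hq]
    conv_lhs => enter [1]; rw [eq_ofCoeffs hq, mul_comm, momentFunctional_ofCoeffs_mul]
    rw [← Finset.sum_add_distrib]
    refine Finset.sum_eq_zero fun i _ => ?_
    rw [add_comm (i : ℕ)]
    ring
  right q hq := by
    rw [momentFunctional_dualPoly_mul hdet _ hq]
    simp [Pi.single_apply]

theorem dualPoly_pow_reproducing (hdet : (hankel μ m).det ≠ 0)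
    (t : ℝ) (q : ℝ[X]) (hq : q.natDegree ≤ m) :
    momentFunctional μ (dualPoly μ (fun i : Fin (m + 1) => t ^ (i : ℕ)) * q) = q.eval t := by
  rw [momentFunctional_dualPoly_mul hdet _ hq]
  conv_rhs => rw [eq_ofCoeffs hq]
  simp [ofCoeffs, eval_finsetSum]

end

end DegenerateJacobi

/-! ### Deformation in t of the orthogonal polynomials and of the Hankel determinant -/

namespace DegenerateJacobi

open Polynomial Matrix Set

/-- The relations satisfied by the moments `μ` of a semiclassical weight with a moving
singularity at `t`, and by the moments `κ`, `ν`, `τ` of its quotients by `x`, `x - 1`, `x - t`. -/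
structure IsMomentSystem (α β γ : ℝ) (μ κ ν τ : ℕ → ℝ → ℝ) : Prop where
  zero : ∀ k, ∀ t ∈ Ioo (0 : ℝ) 1, κ (k + 1) t = μ k t
  one : ∀ k, ∀ t ∈ Ioo (0 : ℝ) 1, ν (k + 1) t - ν k t = μ k t
  pole : ∀ k, ∀ t ∈ Ioo (0 : ℝ) 1, τ (k + 1) t - t * τ k t = μ k t
  pearson : ∀ k : ℕ, ∀ t ∈ Ioo (0 : ℝ) 1,
    (k + α) * κ k t + β * ν k t + γ * τ k t = 0
  hasDerivAt_moment : ∀ k, ∀ t ∈ Ioo (0 : ℝ) 1, HasDerivAt (μ k) (-γ * τ k t) t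
  hasDerivAt_moment_zero : ∀ k, ∀ t ∈ Ioo (0 : ℝ) 1, HasDerivAt (κ k) (-γ / t * (τ k t - κ k t)) t

theorem isDivided_momentFunctional {μ κ : ℕ → ℝ} {c : ℝ} (h : ∀ k, κ (k + 1) - c * κ k = μ k) :
    IsDivided (momentFunctional μ) (momentFunctional κ) c := by
  have : momentFunctional κ ∘ₗ LinearMap.mulLeft ℝ (X - C c) = momentFunctional μ := by
    refine momentFunctional_ext fun k => ?_
    rw [LinearMap.comp_apply, LinearMap.mulLeft_apply, sub_mul, ← pow_succ', map_sub,
      momentFunctional_C_mul_X_pow, momentFunctional_X_pow, momentFunctional_X_pow, h]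
  exact fun p => LinearMap.congr_fun this p

variable {α β γ : ℝ} {μ κ ν τ : ℕ → ℝ → ℝ} {m : ℕ} {t : ℝ}

theorem IsMomentSystem.isPearson (h : IsMomentSystem α β γ μ κ ν τ) (ht : t ∈ Ioo (0 : ℝ) 1) :
    IsPearson α β γ t (momentFunctional fun k => μ k t) (momentFunctional fun k => κ k t)
      (momentFunctional fun k => ν k t) (momentFunctional fun k => τ k t) where
  zero := isDivided_momentFunctional fun k => by rw [h.zero k t ht]; ring
  one := isDivided_momentFunctional fun k => by rw [one_mul, h.one k t ht]
  pole := isDivided_momentFunctional fun k => h.pole k t ht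
  pearson := by
    have : momentFunctional (fun k => μ k t) ∘ₗ derivative
        + α • momentFunctional (fun k => κ k t) + β • momentFunctional (fun k => ν k t)
        + γ • momentFunctional (fun k => τ k t) = 0 := by
      refine momentFunctional_ext fun k => ?_
      have hk := h.pearson k t ht
      rcases k with _ | k
      · simp only [LinearMap.add_apply, LinearMap.comp_apply, LinearMap.smul_apply,
          momentFunctional_X_pow, LinearMap.zero_apply, smul_eq_mul]
        simp only [pow_zero, derivative_one, map_zero]
        simpa using hk
      · simp only [LinearMap.add_apply, LinearMap.comp_apply, LinearMap.smul_apply,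
          momentFunctional_X_pow, LinearMap.zero_apply, smul_eq_mul, derivative_X_pow,
          add_tsub_cancel_right, momentFunctional_C_mul_X_pow]
        -- As κ at k + 1 is μ at k, the term (k+1)κ is L of the derivative of X^(k+1).
        rw [← h.zero k t ht]
        linarith
    exact fun p => LinearMap.congr_fun this p

theorem momentFunctional_orthPoly_mul_X_pow (μ τ : ℕ → ℝ) (m k : ℕ) :
    momentFunctional τ (orthPoly μ m * X ^ k) = τ (m + 1 + k)
      + momentFunctional τ ((dualPoly μ fun i : Fin (m + 1) => -μ (m + 1 + i)) * X ^ k) := by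
  rw [orthPoly, add_mul, map_add, ← pow_add, momentFunctional_X_pow]

/-- If the differentiated linear system has right-hand side r t^i, the derivative of the polynomial
is r times the reproducing kernel at t. Both P and Q satisfy this, since f(P x^i) = t^i f(P) and f(Q
x^i) = t^i f(Q) for i ≤ m. -/
theorem IsMomentSystem.hasDerivAt_coeff_dualPoly (h : IsMomentSystem α β γ μ κ ν τ)
    (ht : t ∈ Ioo (0 : ℝ) 1) (hdet : (hankel (fun k => μ k t) m).det ≠ 0)
    {b : ℝ → Fin (m + 1) → ℝ} {b' : Fin (m + 1) → ℝ} {r : ℝ}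
    (hb : ∀ i, HasDerivAt (fun s => b s i) (b' i) t)
    (hr : ∀ i : Fin (m + 1), b' i
      + γ * momentFunctional (fun k => τ k t) (dualPoly (fun k => μ k t) (b t) * X ^ (i : ℕ))
        = r * t ^ (i : ℕ)) (i : Fin (m + 1)) :
    HasDerivAt (fun s => ((hankel (fun k => μ k s) m)⁻¹ *ᵥ b s) i)
      (r * ((hankel (fun k => μ k t) m)⁻¹ *ᵥ fun i : Fin (m + 1) => t ^ (i : ℕ)) i) t := by
  refine (hasDerivAt_inv_mulVec (A := fun s => hankel (fun k => μ k s) m)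
    (A' := -γ • hankel (fun k => τ k t) m) (fun i j => ?_) hb hdet i).congr_deriv ?_
  · simpa [hankel_apply] using h.hasDerivAt_moment (i + j) t ht
  · have e : b' - (-γ • hankel (fun k => τ k t) m) *ᵥ ((hankel (fun k => μ k t) m)⁻¹ *ᵥ b t)
        = r • fun i : Fin (m + 1) => t ^ (i : ℕ) := by
      funext j
      rw [Pi.smul_apply, smul_eq_mul, ← hr j, smul_mulVec, Pi.sub_apply, Pi.smul_apply,
        hankel_mulVec, dualPoly, smul_eq_mul]
      ring
    rw [e, mulVec_smul, Pi.smul_apply, smul_eq_mul]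

theorem IsMomentSystem.hasDerivAt_orthPoly (h : IsMomentSystem α β γ μ κ ν τ)
    (ht : t ∈ Ioo (0 : ℝ) 1) (hdet : (hankel (fun k => μ k t) m).det ≠ 0) (i : Fin (m + 1)) :
    HasDerivAt (fun s => ((hankel (fun k => μ k s) m)⁻¹ *ᵥ
        fun i : Fin (m + 1) => -μ (m + 1 + i) s) i)
      (γ * momentFunctional (fun k => τ k t) (orthPoly (fun k => μ k t) m)
        * ((hankel (fun k => μ k t) m)⁻¹ *ᵥ fun i : Fin (m + 1) => t ^ (i : ℕ)) i) t := by
  refine h.hasDerivAt_coeff_dualPoly ht hdet (b := fun s i => -μ (m + 1 + i) s)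
    (b' := fun i => γ * τ (m + 1 + i) t) (fun i => ?_) (fun i => ?_) i
  · refine (h.hasDerivAt_moment (m + 1 + i) t ht).fun_neg.congr_deriv ?_
    ring
  · rw [← mul_add, ← momentFunctional_orthPoly_mul_X_pow (fun k => μ k t) (fun k => τ k t),
      (isOrthogonalPair hdet).divided_left_mul (h.isPearson ht).pole
        ((natDegree_X_pow_le _).trans i.2.le), eval_pow, eval_X]
    ring

theorem IsMomentSystem.hasDerivAt_dualPoly_single (h : IsMomentSystem α β γ μ κ ν τ)
    (ht : t ∈ Ioo (0 : ℝ) 1) (hdet : (hankel (fun k => μ k t) m).det ≠ 0) (i : Fin (m + 1)) :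
    HasDerivAt (fun s => ((hankel (fun k => μ k s) m)⁻¹ *ᵥ Pi.single (Fin.last m) 1) i)
      (γ * momentFunctional (fun k => τ k t)
          (dualPoly (fun k => μ k t) (Pi.single (Fin.last m) 1))
        * ((hankel (fun k => μ k t) m)⁻¹ *ᵥ fun i : Fin (m + 1) => t ^ (i : ℕ)) i) t := by
  refine h.hasDerivAt_coeff_dualPoly ht hdet (b := fun _ => Pi.single (Fin.last m) 1)
    (b' := 0) (fun i => hasDerivAt_const _ _) (fun i => ?_) i
  rw [(isOrthogonalPair hdet).divided_right_mul (h.isPearson ht).pole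
        ((natDegree_X_pow_le _).trans i.2.le), eval_pow, eval_X, coeff_X_pow,
        if_neg i.2.ne', Pi.zero_apply]
  ring

theorem coeff_orthPoly (μ : ℕ → ℝ) (m : ℕ) : (orthPoly μ m).coeff m
    = ((hankel μ m)⁻¹ *ᵥ fun i : Fin (m + 1) => -μ (m + 1 + i)) (Fin.last m) := by
  rw [orthPoly, coeff_add, coeff_X_pow, if_neg (Nat.lt_succ_self m).ne, zero_add]
  exact coeff_ofCoeffs _ (Fin.last m)

theorem IsMomentSystem.hasDerivAt_coeff_orthPoly (h : IsMomentSystem α β γ μ κ ν τ)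
    (ht : t ∈ Ioo (0 : ℝ) 1) (hdet : (hankel (fun k => μ k t) m).det ≠ 0) :
    HasDerivAt (fun s => (orthPoly (fun k => μ k s) m).coeff m)
      (γ * ((dualPoly (fun k => μ k t) (Pi.single (Fin.last m) 1)).eval t
        * momentFunctional (fun k => τ k t) (orthPoly (fun k => μ k t) m))) t := by
  simp only [coeff_orthPoly]
  refine (h.hasDerivAt_orthPoly ht hdet (Fin.last m)).congr_deriv ?_
  have hK := (christoffel_darboux (isOrthogonalPair hdet) (eq_zero_of_orthogonal hdet)
    (natDegree_ofCoeffs_le _) (dualPoly_pow_reproducing hdet t)).1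
  rw [← hK]
  have := coeff_ofCoeffs ((hankel (fun k => μ k t) m)⁻¹ *ᵥ fun i : Fin (m + 1) => t ^ (i : ℕ))
    (Fin.last m)
  rw [Fin.val_last] at this
  rw [this]
  ring

/-- With K the kernel at t, P' = γ f(P) K and Q' = γ f(Q) K, while 1/(x(x-t)) = (1/t)(1/(x-t) - 1/x)
governs the derivative of `f₀`. Christoffel-Darboux, evaluated at 0 and under `f₀`, eliminates K. -/
theorem IsMomentSystem.hasDerivAt_residue_zero (h : IsMomentSystem α β γ μ κ ν τ)
    (ht : t ∈ Ioo (0 : ℝ) 1) (hdet : (hankel (fun k => μ k t) m).det ≠ 0)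
    {P Q : ℝ → ℝ[X]} (hP : P = fun s => orthPoly (fun k => μ k s) m)
    (hQ : Q = fun s => dualPoly (fun k => μ k s) (Pi.single (Fin.last m) 1))
    {f₀ f : ℝ → ℝ[X] →ₗ[ℝ] ℝ} (hf₀ : f₀ = fun s => momentFunctional fun k => κ k s)
    (hf : f = fun s => momentFunctional fun k => τ k s) :
    HasDerivAt (fun s => (Q s).eval 0 * f₀ s (P s))
      (γ / t * ((P t).eval t * f t (P t) * ((Q t).eval 0 * f₀ t (Q t))
        - (P t).eval 0 * f₀ t (P t) * ((Q t).eval t * f t (Q t)))) t := by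
  have hw := h.isPearson ht
  have hpair := isOrthogonalPair hdet
  set c : ℝ → Fin (m + 1) → ℝ := fun s =>
    (hankel (fun k => μ k s) m)⁻¹ *ᵥ fun i : Fin (m + 1) => -μ (m + 1 + i) s with hc
  set k₀ : Fin (m + 1) → ℝ :=
    (hankel (fun k => μ k t) m)⁻¹ *ᵥ fun i : Fin (m + 1) => t ^ (i : ℕ) with hk₀
  have hf₀P : ∀ s, f₀ s (P s) = κ (m + 1) s + ∑ i, c s i * κ i s := by
    intro s
    simp only [hf₀, hP, orthPoly, map_add, momentFunctional_X_pow, dualPoly,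
      momentFunctional_ofCoeffs, hc]
  have hfP : f t (P t) = τ (m + 1) t + ∑ i, c t i * τ i t := by
    simp only [hf, hP, orthPoly, map_add, momentFunctional_X_pow, dualPoly,
      momentFunctional_ofCoeffs, hc]
  have hf₀K : f₀ t (ofCoeffs k₀) = ∑ i, k₀ i * κ i t := by
    rw [hf₀, momentFunctional_ofCoeffs]
  have hQ0 : ∀ s, (Q s).eval 0
      = ((hankel (fun k => μ k s) m)⁻¹ *ᵥ Pi.single (Fin.last m) 1) 0 := by
    intro s
    rw [hQ]
    exact eval_zero_ofCoeffs _
  have dc : ∀ i, HasDerivAt (fun s => c s i) (γ * f t (P t) * k₀ i) t := fun i => by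
    rw [hf, hP]
    exact h.hasDerivAt_orthPoly ht hdet i
  have d1 : HasDerivAt (fun s => f₀ s (P s))
      (-γ / t * (f t (P t) - f₀ t (P t)) + γ * f t (P t) * f₀ t (ofCoeffs k₀)) t := by
    simp only [hf₀P, hf₀K]
    refine ((h.hasDerivAt_moment_zero (m + 1) t ht).add
      (HasDerivAt.fun_sum fun i _ => (dc i).mul (h.hasDerivAt_moment_zero i t ht))).congr_deriv ?_
    rw [hfP, Finset.sum_add_distrib, Finset.mul_sum]
    have e1 : ∀ i : Fin (m + 1), c t i * (-γ / t * (τ i t - κ i t))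
        = -γ / t * (c t i * τ i t - c t i * κ i t) := fun i => by ring
    have e2 : ∀ i : Fin (m + 1), γ * (τ (m + 1) t + ∑ i, c t i * τ i t) * k₀ i * κ i t
        = γ * (τ (m + 1) t + ∑ i, c t i * τ i t) * (k₀ i * κ i t) := fun i => by ring
    simp only [e1, e2, ← Finset.mul_sum, Finset.sum_sub_distrib]
    ring
  have d2 : HasDerivAt (fun s => (Q s).eval 0)
      (γ * f t (Q t) * (ofCoeffs k₀).eval 0) t := by
    simp only [hQ0]
    rw [eval_zero_ofCoeffs, hf, hQ]
    exact h.hasDerivAt_dualPoly_single ht hdet 0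
  refine (d2.mul d1).congr_deriv ?_
  have hK := (christoffel_darboux hpair (eq_zero_of_orthogonal hdet)
    (natDegree_ofCoeffs_le _) (dualPoly_pow_reproducing hdet t)).2
  have hK' : (X - C t) * ofCoeffs k₀ = (Q t).eval t • P t - (P t).eval t • Q t := by
    rw [hP, hQ]
    exact hK
  have hL := dualPoly_pow_reproducing hdet t 1 (by simp)
  rw [mul_one, eval_one] at hL
  have a1 : -t * (ofCoeffs k₀).eval 0
      = (Q t).eval t * (P t).eval 0 - (P t).eval t * (Q t).eval 0 := by
    simpa using congrArg (eval 0) hK'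
  have a2 : 1 - t * f₀ t (ofCoeffs k₀)
      = (Q t).eval t * f₀ t (P t) - (P t).eval t * f₀ t (Q t) := by
    have e := congrArg (f₀ t) hK'
    have e' : (X - C t) * ofCoeffs k₀ = (X - C 0) * ofCoeffs k₀ - t • ofCoeffs k₀ := by
      rw [smul_eq_C_mul, C_0]; ring
    rw [e', map_sub, map_sub, map_smul, map_smul, map_smul] at e
    -- Multiplying by X turns `f₀` into L, and L(K) = 1 is the reproducing property at the constant
    -- 1.
    have e0 : f₀ t ((X - C 0) * ofCoeffs k₀) = 1 := by
      rw [hf₀, hw.zero]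
      exact hL
    rw [e0] at e
    exact e
  have wt : (Q t).eval t * f t (P t) = (P t).eval t * f t (Q t) + 1 := by
    rw [hP, hQ, hf]
    exact hpair.wronskian hw.pole
  have ht0 : t ≠ 0 := ht.1.ne'
  field_simp
  linear_combination (-γ * f t (Q t) * f₀ t (P t)) * a1
    - γ * f t (P t) * (Q t).eval 0 * a2 - γ * (Q t).eval 0 * f₀ t (P t) * wt

/-- The diagonal of the companion-type matrix of multiplication by `x`. -/
theorem hankel_inv_mul_shift {μ : ℕ → ℝ} (hdet : (hankel μ m).det ≠ 0) (j : Fin (m + 1)) :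
    ((hankel μ m)⁻¹ * hankel (fun k => μ (k + 1)) m) j j
      = if j = Fin.last m then -(orthPoly μ m).coeff m else 0 := by
  have hcol : ((hankel μ m)⁻¹ * hankel (fun k => μ (k + 1)) m) j j
      = ((hankel μ m)⁻¹ *ᵥ fun i => μ (i + j + 1)) j := rfl
  rw [hcol]
  split_ifs with hj
  · subst hj
    rw [coeff_orthPoly]
    have : (fun i : Fin (m + 1) => μ ((i : ℕ) + ((Fin.last m : Fin (m + 1)) : ℕ) + 1))
        = -fun i : Fin (m + 1) => -μ (m + 1 + i) := by
      funext i
      rw [Pi.neg_apply, neg_neg, Fin.val_last]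
      congr 1
      ring
    rw [this, mulVec_neg, Pi.neg_apply]
  · have hlt : (j : ℕ) + 1 < m + 1 := by
      have : (j : ℕ) ≠ m := fun h => hj (Fin.ext h)
      omega
    -- Before the last, column j of the shifted matrix is column j + 1 of the Hankel matrix, so the
    -- inverse sends it to a basis vector with zero in place j.
    have : (fun i : Fin (m + 1) => μ (i + j + 1))
        = hankel μ m *ᵥ Pi.single ⟨j + 1, hlt⟩ 1 := by
      funext i
      rw [mulVec_single_one]
      rfl
    rw [this, mulVec_mulVec, nonsing_inv_mul _ hdet.isUnit, one_mulVec, Pi.single_apply, if_neg]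
    intro h
    have := congrArg Fin.val h
    simp at this

/-- Pearson's relation for x^(k+1)(1-x), which cancels the poles at 0 and 1; division by x - t
leaves the remainder t(1-t)τ. -/
theorem IsMomentSystem.mul_deriv (h : IsMomentSystem α β γ μ κ ν τ)
    (ht : t ∈ Ioo (0 : ℝ) 1) (k : ℕ) :
    t * (1 - t) * (-γ * τ k t)
      = (k + 1 + α + γ * (1 - t)) * μ k t - (k + 2 + α + β + γ) * μ (k + 1) t := by
  have p1 := h.pearson (k + 1) t ht
  have p2 := h.pearson (k + 2) t ht
  have t0 := h.pole k t ht
  have t1 := h.pole (k + 1) t ht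
  have o1 := h.one (k + 1) t ht
  rw [h.zero k t ht] at p1
  rw [h.zero (k + 1) t ht] at p2
  push_cast at p1 p2
  linear_combination -p1 + p2 + β * (-o1) + γ * (-t1 - t * t0 + t0)

/-- In Jacobi's formula the factor k = i + j of `mul_deriv` becomes multiplication by Λ on the left
and on the right. The traces are explicit because the inverse Hankel matrix times its shift has
diagonal (0, …, 0, -p). -/
theorem IsMomentSystem.hasDerivAt_det_hankel (h : IsMomentSystem α β γ μ κ ν τ)
    (ht : t ∈ Ioo (0 : ℝ) 1) (hdet : (hankel (fun k => μ k t) m).det ≠ 0) :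
    HasDerivAt (fun s => (hankel (fun k => μ k s) m).det)
      ((hankel (fun k => μ k t) m).det / (t * (1 - t))
        * ((2 * (m + 1) + α + β + γ) * (orthPoly (fun k => μ k t) m).coeff m
          + (m + 1) * (m + 1 + α + γ * (1 - t)))) t := by
  set M := hankel (fun k => μ k t) m with hM
  set S := hankel (fun k => μ (k + 1) t) m with hS
  set p := (orthPoly (fun k => μ k t) m).coeff m with hp
  set Λ : Matrix (Fin (m + 1)) (Fin (m + 1)) ℝ := diagonal fun i => (i : ℝ) with hΛ
  have ht1 : t * (1 - t) ≠ 0 := mul_ne_zero ht.1.ne' (by linarith [ht.2])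
  refine (hasDerivAt_det (A := fun s => hankel (fun k => μ k s) m)
    (A' := -γ • hankel (fun k => τ k t) m) fun i j => ?_).congr_deriv ?_
  · simpa [hankel_apply] using h.hasDerivAt_moment (i + j) t ht
  have hadj : M.adjugate = M.det • M⁻¹ := by
    rw [inv_def, smul_smul, Ring.mul_inverse_cancel _ hdet.isUnit, one_smul]
  have hA' : (t * (1 - t)) • (-γ • hankel (fun k => τ k t) m)
      = (1 + α + γ * (1 - t)) • M + Λ * M + M * Λ
        - ((2 + α + β + γ) • S + Λ * S + S * Λ) := by
    ext i j
    have e := h.mul_deriv ht (i + j)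
    simp only [Matrix.smul_apply, Matrix.sub_apply, Matrix.add_apply, hΛ, diagonal_mul, mul_diagonal, hM, hS,
      hankel_apply, smul_eq_mul]
    push_cast at e
    linear_combination e
  have hMi : M⁻¹ * M = 1 := nonsing_inv_mul _ hdet.isUnit
  have hMi' : M * M⁻¹ = 1 := mul_nonsing_inv _ hdet.isUnit
  have tr1 : (M⁻¹ * S).trace = -p := by
    simp [trace, hM, hS, hankel_inv_mul_shift hdet, hp]
  have trS : (M⁻¹ * (S * Λ)).trace = -(m * p) := by
    rw [← Matrix.mul_assoc, trace]
    simp only [diag_apply, hΛ, mul_diagonal, hM, hS, hankel_inv_mul_shift hdet]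
    simp [hp, mul_comm]
  have trS' : (M⁻¹ * (Λ * S)).trace = -(m * p) := by
    rw [← trS, ← trace_transpose, transpose_mul, transpose_mul, transpose_nonsing_inv, hM, hS,
      hankel_transpose, hankel_transpose, hΛ, diagonal_transpose, trace_mul_comm]
  have trM : (M⁻¹ * (M * Λ)).trace = m * (m + 1) / 2 := by
    rw [← Matrix.mul_assoc, hMi, Matrix.one_mul, hΛ, trace_diagonal,
      Fin.sum_univ_eq_sum_range (fun i => (i : ℝ))]
    have := Finset.sum_range_id_mul_two (m + 1)
    have hc : ((∑ i ∈ Finset.range (m + 1), i : ℕ) : ℝ) * 2 = (m + 1) * m := by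
      exact_mod_cast this
    push_cast at hc
    linarith
  have trM' : (M⁻¹ * (Λ * M)).trace = m * (m + 1) / 2 := by
    rw [← trM, trace_mul_comm, Matrix.mul_assoc, hMi', Matrix.mul_one, ← Matrix.mul_assoc, hMi,
      Matrix.one_mul]
  have key : t * (1 - t) * (M⁻¹ * (-γ • hankel (fun k => τ k t) m)).trace
      = (2 * (m + 1) + α + β + γ) * p + (m + 1) * (m + 1 + α + γ * (1 - t)) := by
    rw [← smul_eq_mul, ← trace_smul, ← Matrix.mul_smul, hA']
    simp only [Matrix.mul_sub, Matrix.mul_add, Matrix.mul_smul, trace_sub, trace_add, trace_smul,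
      hMi, trace_one, tr1, trS, trS', trM, trM', smul_eq_mul, Fintype.card_fin]
    push_cast
    ring
  rw [← key, hadj, Matrix.smul_mul, trace_smul, smul_eq_mul, ← mul_assoc,
    div_mul_cancel₀ _ ht1]

end DegenerateJacobi

/-! ### The moment system of the weight and the σ-form -/

namespace DegenerateJacobi

open Polynomial Matrix Set Topology

variable {α β γ A B : ℝ}

/-- Dividing the weight by x, x - 1 or x - t lowers one exponent by 1, with a global sign for x - 1
and a sign on the left part for x - t. Positivity of α, β, γ keeps all exponents above -1. -/
theorem isMomentSystem_splitInt (hα : 0 < α) (hβ : 0 < β) (hγ : 0 < γ) (A C : ℝ) :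
    IsMomentSystem α β γ (fun k => splitInt A C (α + k) β γ)
      (fun k => splitInt A C (α + k - 1) β γ) (fun k t => -splitInt A C (α + k) (β - 1) γ t)
      (fun k => splitInt (-A) C (α + k) β (γ - 1)) where
  zero k t _ := by
    push_cast
    rw [← add_assoc, add_sub_cancel_right]
  one k t ht := by
    have h := splitInt_add_one_left (A := A) (C := C) (a := α + k) (b := β - 1) (c := γ)
      (by linarith [k.cast_nonneg (α := ℝ)]) (by linarith) (by linarith) ht
    rw [sub_add_cancel] at h
    push_cast
    rw [← add_assoc]
    linarith
  pole k t ht := by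
    have h := splitInt_sub_mul (A := -A) (C := C) (a := α + k) (b := β) (c := γ - 1)
      (by linarith [k.cast_nonneg (α := ℝ)]) (by linarith) (by linarith) ht
    rw [sub_add_cancel, neg_neg] at h
    push_cast
    rw [← add_assoc]
    exact h
  pearson k t ht := by
    have h := splitInt_by_parts (A := A) (C := C) (a := α + k) (b := β) (c := γ)
      (by linarith [k.cast_nonneg (α := ℝ)]) hβ hγ ht
    linarith
  hasDerivAt_moment k t ht := hasDerivAt_splitInt (by linarith [k.cast_nonneg (α := ℝ)])
    (by linarith) hγ ht
  hasDerivAt_moment_zero k t ht := by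
    have hk : -1 < α + k - 1 := by linarith [k.cast_nonneg (α := ℝ)]
    refine (hasDerivAt_splitInt hk (by linarith) hγ ht).congr_deriv ?_
    have h := splitInt_sub_mul (A := -A) (C := C) (a := α + k - 1) (b := β) (c := γ - 1)
      hk (by linarith) (by linarith) ht
    rw [sub_add_cancel, sub_add_cancel, neg_neg] at h
    rw [← h]
    field_simp [ht.1.ne']
    ring

theorem hankelDet_eq (hα : 0 < α) (hβ : 0 < β) (hγ : 0 < γ) (m : ℕ) {t : ℝ}
    (ht : t ∈ Ioo (0 : ℝ) 1) : hankelDet α β γ A B (m + 1) t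
      = (hankel (fun k => splitInt A (A + B) (α + k) β γ t) m).det := by
  rw [hankelDet]
  congr 1
  ext i j
  exact moment_eq_splitInt hα hβ hγ _ ht

theorem SolvesSigmaPVI.of_residues {N : ℝ} {H p g W : ℝ → ℝ}
    (hH : ∀ t ∈ Ioo (0 : ℝ) 1,
      H t = -((2 * N + α + β + γ) * p t + N * (N + α + γ * (1 - t))))
    (hp : ∀ t ∈ Ioo (0 : ℝ) 1, HasDerivAt p (g t) t)
    (hg : ∀ t ∈ Ioo (0 : ℝ) 1, HasDerivAt g (α * γ * W t / (t * (t - 1))) t)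
    (hW : ∀ t ∈ Ioo (0 : ℝ) 1, (α * γ * W t) ^ 2
      = ((p t - t * g t) * (p t - t * g t - β)
          - ((t - 1) * g t - N - p t) * ((t - 1) * g t - N - p t - α) - g t * (g t - γ)) ^ 2
        - 4 * (((t - 1) * g t - N - p t) * ((t - 1) * g t - N - p t - α))
          * (g t * (g t - γ))) :
    SolvesSigmaPVI ((α + β) / 2) ((β - α) / 2) ((2 * N + α + β) / 2)
      ((2 * N + α + β + 2 * γ) / 2)
      (fun t => H t + (-N * (N + α + β + γ) - (α + β) ^ 2 / 4) * t
        + (1 / 4) * (2 * N * (N + α + β + γ) + (α + β) * β - (α - β) * γ)) (Ioo 0 1) := by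
  set c₁ := -N * (N + α + β + γ) - (α + β) ^ 2 / 4 with hc₁
  set c₂ := (1 / 4) * (2 * N * (N + α + β + γ) + (α + β) * β - (α - β) * γ) with hc₂
  have d1 : ∀ t ∈ Ioo (0 : ℝ) 1, HasDerivAt (fun t => H t + c₁ * t + c₂)
      (-(2 * N + α + β + γ) * g t + N * γ + c₁) t := by
    intro t ht
    have e : (fun t => H t + c₁ * t + c₂) =ᶠ[𝓝 t] fun t =>
        -(2 * N + α + β + γ) * p t + (N * γ + c₁) * t + (-N * (N + α + γ) + c₂) := by
      filter_upwards [isOpen_Ioo.mem_nhds ht] with s hs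
      rw [hH s hs]
      ring
    refine (((((hp t ht).const_mul _).add ((hasDerivAt_id t).const_mul _)).add_const
      _).congr_of_eventuallyEq e).congr_deriv ?_
    ring
  intro t ht
  have d2 : HasDerivAt (deriv fun t => H t + c₁ * t + c₂)
      (-(2 * N + α + β + γ) * (α * γ * W t / (t * (t - 1)))) t := by
    have e : deriv (fun t => H t + c₁ * t + c₂) =ᶠ[𝓝 t] fun t =>
        -(2 * N + α + β + γ) * g t + (N * γ + c₁) := by
      filter_upwards [isOpen_Ioo.mem_nhds ht] with s hs
      rw [(d1 s hs).deriv]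
      ring
    exact (((hg t ht).const_mul _).add_const _).congr_of_eventuallyEq e
  refine ⟨(d1 t ht).differentiableAt, d2.differentiableAt, ?_⟩
  have ht1 : t * (t - 1) ≠ 0 := mul_ne_zero ht.1.ne' (by linarith [ht.2])
  rw [(d1 t ht).deriv, d2.deriv]
  refine sigma_form_of_residues (p := p t) (g := g t) ?_ ?_ ?_
  · simp only [hH t ht, hc₁, hc₂]
    ring
  · rfl
  · rw [mul_left_comm, mul_div_cancel₀ _ ht1, mul_pow, hW t ht]
    ring

theorem IsMomentSystem.solvesSigmaPVI {μ κ ν τ : ℕ → ℝ → ℝ} {m : ℕ} {D : ℝ → ℝ}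
    (h : IsMomentSystem α β γ μ κ ν τ)
    (hD : ∀ t ∈ Ioo (0 : ℝ) 1, D t = (hankel (fun k => μ k t) m).det)
    (hD0 : ∀ t ∈ Ioo (0 : ℝ) 1, D t ≠ 0) {N : ℝ} (hN : N = m + 1) :
    (∀ t ∈ Ioo (0 : ℝ) 1, DifferentiableAt ℝ D t) ∧
    SolvesSigmaPVI ((α + β) / 2) ((β - α) / 2) ((2 * N + α + β) / 2)
      ((2 * N + α + β + 2 * γ) / 2)
      (fun t => t * (t - 1) * deriv (fun s => Real.log (D s)) t
        + (-N * (N + α + β + γ) - (α + β) ^ 2 / 4) * t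
        + (1 / 4) * (2 * N * (N + α + β + γ) + (α + β) * β - (α - β) * γ)) (Ioo 0 1) := by
  subst hN
  have hdet : ∀ t ∈ Ioo (0 : ℝ) 1, (hankel (fun k => μ k t) m).det ≠ 0 := fun t ht =>
    hD t ht ▸ hD0 t ht
  have dD : ∀ t ∈ Ioo (0 : ℝ) 1, HasDerivAt D (D t / (t * (1 - t))
        * ((2 * (m + 1) + α + β + γ) * (orthPoly (fun k => μ k t) m).coeff m
          + (m + 1) * (m + 1 + α + γ * (1 - t)))) t := by
    intro t ht
    rw [hD t ht]
    refine (h.hasDerivAt_det_hankel ht (hdet t ht)).congr_of_eventuallyEq ?_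
    filter_upwards [isOpen_Ioo.mem_nhds ht] with s hs using hD s hs
  refine ⟨fun t ht => (dD t ht).differentiableAt, ?_⟩
  set P : ℝ → ℝ[X] := fun s => orthPoly (fun k => μ k s) m with hP
  set Q : ℝ → ℝ[X] := fun s => dualPoly (fun k => μ k s) (Pi.single (Fin.last m) 1) with hQ
  set f₀ : ℝ → ℝ[X] →ₗ[ℝ] ℝ := fun s => momentFunctional fun k => κ k s with hf₀
  set f : ℝ → ℝ[X] →ₗ[ℝ] ℝ := fun s => momentFunctional fun k => τ k s with hf
  set p : ℝ → ℝ := fun s => (P s).coeff m with hp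
  set g : ℝ → ℝ := fun s => γ * ((Q s).eval s * f s (P s)) with hg
  set y : ℝ → ℝ := fun s => (Q s).eval 0 * f₀ s (P s) with hy
  set W : ℝ → ℝ := fun t => (P t).eval t * f t (P t) * ((Q t).eval 0 * f₀ t (Q t))
        - (P t).eval 0 * f₀ t (P t) * ((Q t).eval t * f t (Q t)) with hW
  have res : ∀ t ∈ Ioo (0 : ℝ) 1, α * y t = (t - 1) * g t - (m + 1) - p t ∧ _ := fun t ht =>
    residue_relation (h.isPearson ht) (isOrthogonalPair (hdet t ht)) (p := p t) (g := g t)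
      (N := m + 1) (W := W t) rfl rfl rfl rfl
  have dp : ∀ t ∈ Ioo (0 : ℝ) 1, HasDerivAt p (g t) t := fun t ht =>
    h.hasDerivAt_coeff_orthPoly ht (hdet t ht)
  have dy : ∀ t ∈ Ioo (0 : ℝ) 1, HasDerivAt y (γ / t * W t) t := fun t ht =>
    h.hasDerivAt_residue_zero ht (hdet t ht) hP hQ hf₀ hf
  refine SolvesSigmaPVI.of_residues (p := p) (g := g) (W := W) (fun t ht => ?_) dp
    (fun t ht => ?_) (fun t ht => (res t ht).2)
  · have ht0 := ht.1.ne'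
    have ht1 : 1 - t ≠ 0 := by linarith [ht.2]
    have hD0' := hD0 t ht
    rw [((dD t ht).log hD0').deriv]
    change t * (t - 1) * (D t / (t * (1 - t)) * ((2 * (m + 1) + α + β + γ) * p t
          + (m + 1) * (m + 1 + α + γ * (1 - t))) / D t) = _
    field_simp
    ring
  · have ht0 := ht.1.ne'
    have ht1 : t - 1 ≠ 0 := by linarith [ht.2]
    -- Differentiating g directly would require the derivative of τ, whose exponent γ - 1 need not
    -- be positive. The residue at 0 determines g, and its derivative is known.
    have e : g =ᶠ[𝓝 t] fun s => (α * y s + (m + 1) + p s) / (s - 1) := by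
      filter_upwards [isOpen_Ioo.mem_nhds ht] with s hs
      have hs1 : s - 1 ≠ 0 := by linarith [hs.2]
      rw [(res s hs).1, eq_div_iff hs1]
      ring
    refine ((((((dy t ht).const_mul α).add_const _).add (dp t ht)).div
      ((hasDerivAt_id t).sub_const 1) ht1).congr_of_eventuallyEq e).congr_deriv ?_
    simp only [id, Pi.add_apply, (res t ht).1]
    field_simp
    ring

end DegenerateJacobi

theorem mainTheorem2 (n : ℕ) (α β γ A B : ℝ) (hα : 0 < α) (hβ : 0 < β) (hγ : 0 < γ)
    (hA : 0 ≤ A) (hAB : 0 ≤ A + B) (hne : ¬ (A = 0 ∧ B = 0)) :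
    (∀ t ∈ Set.Ioo (0 : ℝ) 1,
      0 < DegenerateJacobi.hankelDet α β γ A B n t ∧
      DifferentiableAt ℝ (DegenerateJacobi.hankelDet α β γ A B n) t) ∧
    DegenerateJacobi.SolvesSigmaPVI
      ((α + β) / 2) ((β - α) / 2)
      ((2 * (n : ℝ) + α + β) / 2) ((2 * (n : ℝ) + α + β + 2 * γ) / 2)
      (fun t => DegenerateJacobi.hamiltonian α β γ A B n t
        + (-(n : ℝ) * ((n : ℝ) + α + β + γ) - (α + β) ^ 2 / 4) * t
        + (1 / 4) * (2 * (n : ℝ) * ((n : ℝ) + α + β + γ) + (α + β) * β - (α - β) * γ))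
      (Set.Ioo 0 1) := by
  have hpos : ∀ t ∈ Set.Ioo (0 : ℝ) 1, 0 < DegenerateJacobi.hankelDet α β γ A B n t :=
    fun t ht => DegenerateJacobi.hankelDet_pos hα hβ hγ hA hAB hne n ht
  rcases n with _ | m
  · have h1 : DegenerateJacobi.hankelDet α β γ A B 0 = fun _ => 1 :=
      funext fun t => Matrix.det_isEmpty
    refine ⟨fun t ht => ⟨hpos t ht, by rw [h1]; fun_prop⟩, ?_⟩
    -- For n = 0 the determinant is 1 and H = 0, so zero residue data satisfy all relations with N =
    -- 0.
    refine DegenerateJacobi.SolvesSigmaPVI.of_residues (p := 0) (g := 0) (W := 0)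
      (fun t _ => ?_) (fun t _ => hasDerivAt_const t 0) (fun t _ => ?_) (fun t _ => ?_)
    · simp [DegenerateJacobi.hamiltonian, h1]
    · simp
    · simp
  · obtain ⟨hd, hs⟩ := (DegenerateJacobi.isMomentSystem_splitInt hα hβ hγ A
      (A + B)).solvesSigmaPVI (fun t ht => DegenerateJacobi.hankelDet_eq hα hβ hγ m ht)
      (fun t ht => (hpos t ht).ne') (Nat.cast_succ m)
    exact ⟨fun t ht => ⟨hpos t ht, hd t ht⟩, hs⟩
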